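/- **Setting.** Let $(X_n)_{n\ge 1}$ and $(A_n)_{n\ge 1}$ be inductive families of non-empty finite sets, that is, $X_{n+1}=X_n\times[d^X_n]$ and $A_{n+1}=A_n\times[d^A_n]$ with integers $d^X_n,d^A_n\ge 1$; put $d^X_0=|X_1|$, $d^A_0=|A_1|$. Let $\Omega_X=\prod_{n\ge 0}[d^X_n]$ and $\Omega_A=\prod_{n\ge 0}[d^A_n]$ be the associated Cantor spaces, and let $\mu_X$ be the product of the uniform probability measures on $\Omega_X$. For $x\in X_n$ let $\tilde x\subseteq\Omega_X$ be the cylinder of the points whose initial coordinates are given by $x$. For a finite set $A_0$ let $\mathcal D_{A_0}$ be the algebra of diagonal $A_0\times A_0$ matrices, and for finite sets $X_0,A_0$ let $\mathcal S_{X_0,A_0}$ be the coproduct, in the category of operator systems and unital completely positive (UCP) maps, of $|X_0|$ copies of $\mathcal D_{A_0}$, with canonical embeddings $\iota_x:\mathcal D_{A_0}\to\mathcal S_{X_0,A_0}$, $x\in X_0$. Let $\gamma_n:\mathcal S_{X_n,A_n}\to\mathcal S_{X_{n+1},A_{n+1}}$ be the UCP map with $$\gamma_n(\iota_x(u))=\frac1{d^X_n}\sum_{k=1}^{d^X_n}\iota_{(x,k)}(u\otimes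 I),\qquad x\in X_n,\ u\in\mathcal D_{A_n},$$ let $\mathcal S_{X,A}=\varinjlim\mathcal S_{X_n,A_n}$ be the inductive limit of the resulting sequence of operator systems, and let $\gamma^{(n)}:\mathcal S_{X_n,A_n}\to\mathcal S_{X,A}$ be the canonical maps. Let $H$ be a Hilbert space, let $L^\infty(\Omega_X)\bar\otimes\mathcal B(H)$ be the von Neumann algebra tensor product, acting on $L^2(\Omega_X,\mu_X)\otimes H=L^2(\Omega_X,\mu_X;H)$, and let $\tilde{\mathcal E}_n:L^\infty(\Omega_X)\bar\otimes\mathcal B(H)\to\mathcal D_{X_n}\otimes\mathcal B(H)$ be the conditional expectation, so that $\tilde{\mathcal E}_n(S)=\sum_{x\in X_n}\delta_x\otimes\tilde{\mathcal E}_n(S)_x$ with $$\langle\tilde{\mathcal E}_n(S)_x\,\xi,\eta\rangle=|X_n|\,\langle S(\chi_{\tilde x}\otimes\xi),\chi_{\tilde x}\otimes\eta\rangle,\qquad \xi,\eta\in H.$$ Let $\iota_A^{(n)}:\mathcal D_{A_n}\to C(\Omega_A)$ be the canonical inclusion, which identifies the functions on $A_n$ with the functions on $\Omega_A$ that depend only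 on the corresponding initial coordinates. **Theorem.** There is a bijection $\Gamma\leftrightarrow\Phi$ between the unital completely positive maps $\Gamma:\mathcal S_{X,A}\to\mathcal B(H)$ and the unital completely positive maps $\Phi:C(\Omega_A)\to L^\infty(\Omega_X)\bar\otimes\mathcal B(H)$, under which $\Gamma$ corresponds to $\Phi$ if and only if $$(\tilde{\mathcal E}_n\circ\Phi\circ\iota_A^{(n)})(u)=\sum_{x\in X_n}\delta_x\otimes\Gamma\big(\gamma^{(n)}(\iota_x(u))\big)\qquad\text{for all }n\ge 1\text{ and }u\in\mathcal D_{A_n}.$$ -/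

import Mathlib

noncomputable section

set_option linter.unusedSectionVars false

namespace CantorOpSys

open Filter MeasureTheory
open scoped Matrix ComplexOrder

/-! ### Matricially ordered spaces and operator systems -/

/-- The product `α* A α` of a matrix `A` over `V` with a scalar matrix `α`. -/
def compress {V : Type*} [AddCommGroup V] [Module ℂ V] {n m : ℕ}
    (α : Matrix (Fin n) (Fin m) ℂ) (A : Matrix (Fin n) (Fin n) V) : Matrix (Fin m) (Fin m) V :=
  fun i j => ∑ k, ∑ l, (star (α k i) * α l j) • A k l

/-- A complex `*`-vector space with a consistent family of matrix cones of hermitian matrices and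
a matrix order unit.  (Neither properness of the cones nor the Archimedean property is required
at this stage; they are added in `OperatorSystem`.) -/
class MatrixOrdered (V : Type*) [AddCommGroup V] [Module ℂ V] [StarAddMonoid V]
    [StarModule ℂ V] where
  /-- the order unit `e` -/
  ordUnit : V
  /-- the cone `M_n(V)⁺` -/
  cone : ∀ n : ℕ, Set (Matrix (Fin n) (Fin n) V)
  isHermitian_of_mem : ∀ {n : ℕ} {A : Matrix (Fin n) (Fin n) V}, A ∈ cone n → Aᴴ = A
  add_mem : ∀ {n : ℕ} {A B : Matrix (Fin n) (Fin n) V},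
    A ∈ cone n → B ∈ cone n → A + B ∈ cone n
  smul_mem : ∀ {n : ℕ} {A : Matrix (Fin n) (Fin n) V} {r : ℝ},
    0 ≤ r → A ∈ cone n → (r : ℂ) • A ∈ cone n
  compress_mem : ∀ {n m : ℕ} {A : Matrix (Fin n) (Fin n) V} (α : Matrix (Fin n) (Fin m) ℂ),
    A ∈ cone n → compress α A ∈ cone m
  exists_unit_add_mem : ∀ {n : ℕ} {A : Matrix (Fin n) (Fin n) V}, Aᴴ = A →
    ∃ r : ℝ, 0 < r ∧ (r : ℂ) • Matrix.diagonal (fun _ => ordUnit) + A ∈ cone n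

open MatrixOrdered (ordUnit cone)

/-- The diagonal matrix `eₙ = diag(e, …, e)`. -/
def unitMat (V : Type*) [AddCommGroup V] [Module ℂ V] [StarAddMonoid V] [StarModule ℂ V]
    [MatrixOrdered V] (n : ℕ) : Matrix (Fin n) (Fin n) V :=
  Matrix.diagonal fun _ => ordUnit

/-- An (abstract) operator system: a matricially ordered space with proper cones whose matrix
order unit is Archimedean. -/
class OperatorSystem (V : Type*) [AddCommGroup V] [Module ℂ V] [StarAddMonoid V]
    [StarModule ℂ V] extends MatrixOrdered V where
  eq_zero_of_mem_neg_mem : ∀ {n : ℕ} {A : Matrix (Fin n) (Fin n) V},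
    A ∈ cone n → -A ∈ cone n → A = 0
  archimedean : ∀ {n : ℕ} {A : Matrix (Fin n) (Fin n) V},
    (∀ r : ℝ, 0 < r → (r : ℂ) • unitMat V n + A ∈ cone n) → A ∈ cone n

section Basic

variable {V W : Type*} [AddCommGroup V] [Module ℂ V] [StarAddMonoid V] [StarModule ℂ V]
  [AddCommGroup W] [Module ℂ W] [StarAddMonoid W] [StarModule ℂ W]

theorem compress_add {n m : ℕ} (α : Matrix (Fin n) (Fin m) ℂ) (A B : Matrix (Fin n) (Fin n) V) :
    compress α (A + B) = compress α A + compress α B := by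
  ext i j
  simp [compress, Finset.sum_add_distrib]

theorem compress_smul {n m : ℕ} (α : Matrix (Fin n) (Fin m) ℂ) (c : ℂ)
    (A : Matrix (Fin n) (Fin n) V) : compress α (c • A) = c • compress α A := by
  ext i j
  simp [compress, Finset.smul_sum, smul_comm c]

theorem compress_map {n m : ℕ} (f : V →ₗ[ℂ] W) (α : Matrix (Fin n) (Fin m) ℂ)
    (A : Matrix (Fin n) (Fin n) V) : compress α (A.map f) = (compress α A).map f := by
  ext i j
  simp [compress]

theorem conjTranspose_compress {n m : ℕ} (α : Matrix (Fin n) (Fin m) ℂ)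
    (A : Matrix (Fin n) (Fin n) V) : (compress α A)ᴴ = compress α Aᴴ := by
  ext i j
  simp only [compress, Matrix.conjTranspose_apply, star_sum, star_smul, star_mul, star_star]
  rw [Finset.sum_comm]

/-- The scalar `ΣΣ conj(αₖ) αₗ Aₖₗ`, the compression of `A` by a column. -/
def quad {n : ℕ} (α : Fin n → ℂ) (A : Matrix (Fin n) (Fin n) V) : V :=
  ∑ k, ∑ l, (star (α k) * α l) • A k l

theorem quad_add {n : ℕ} (α : Fin n → ℂ) (A B : Matrix (Fin n) (Fin n) V) :
    quad α (A + B) = quad α A + quad α B := by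
  simp [quad, Finset.sum_add_distrib]

theorem quad_smul {n : ℕ} (α : Fin n → ℂ) (c : ℂ) (A : Matrix (Fin n) (Fin n) V) :
    quad α (c • A) = c • quad α A := by
  simp [quad, Finset.smul_sum, smul_comm c]

theorem quad_map {n : ℕ} (f : V →ₗ[ℂ] W) (α : Fin n → ℂ) (A : Matrix (Fin n) (Fin n) V) :
    quad α (A.map f) = f (quad α A) := by
  simp [quad]

theorem quad_polarization {n : ℕ} (i j : Fin n) (c : ℂ) (A : Matrix (Fin n) (Fin n) V) :
    quad (Pi.single i 1 + c • Pi.single j 1) A - quad (Pi.single i 1 - c • Pi.single j 1) A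
      = (2 : ℂ) • (c • A i j + star c • A j i) := by
  have h : ∀ (a b : Fin n → ℂ), quad (a + c • b) A - quad (a - c • b) A
      = ∑ k, ∑ l, (2 * (c * (star (a k) * b l)) + 2 * (star c * (star (b k) * a l))) • A k l := by
    intro a b
    simp only [quad, ← Finset.sum_sub_distrib, ← sub_smul]
    refine Finset.sum_congr rfl fun k _ => Finset.sum_congr rfl fun l _ => ?_
    congr 1
    simp only [Pi.add_apply, Pi.sub_apply, Pi.smul_apply, smul_eq_mul, star_add, star_sub,
      star_mul]
    ring
  rw [h]
  simp only [add_smul, Finset.sum_add_distrib, Pi.single_apply, apply_ite star, star_one,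
    star_zero, smul_add]
  simp [mul_smul]

variable [MatrixOrdered V]

theorem unitMat_mem (n : ℕ) : unitMat V n ∈ cone (V := V) n := by
  obtain ⟨r, hr, h⟩ := MatrixOrdered.exists_unit_add_mem (V := V) (n := n) (A := 0) (by simp)
  have := MatrixOrdered.smul_mem (r := r⁻¹) (by positivity) h
  rw [add_zero, smul_smul, ← Complex.ofReal_mul, inv_mul_cancel₀ hr.ne'] at this
  rwa [Complex.ofReal_one, one_smul] at this

/-- `v` belongs to the first cone. -/
def Pos (v : V) : Prop := (fun _ _ => v : Matrix (Fin 1) (Fin 1) V) ∈ cone (V := V) 1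

theorem Pos.add {v w : V} (hv : Pos v) (hw : Pos w) : Pos (v + w) :=
  MatrixOrdered.add_mem hv hw

theorem Pos.smul {v : V} {r : ℝ} (hr : 0 ≤ r) (hv : Pos v) : Pos ((r : ℂ) • v) :=
  MatrixOrdered.smul_mem hr hv

theorem Pos.star_eq {v : V} (hv : Pos v) : star v = v :=
  congrFun (congrFun (MatrixOrdered.isHermitian_of_mem hv) 0) 0

theorem pos_unit : Pos (ordUnit : V) := by
  have h := unitMat_mem (V := V) 1
  have : unitMat V 1 = fun _ _ => ordUnit := by
    ext i j
    simp [unitMat, Subsingleton.elim i j]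
  rwa [this] at h

theorem star_ordUnit : star (ordUnit : V) = ordUnit := pos_unit.star_eq

theorem pos_quad {n : ℕ} (α : Fin n → ℂ) {A : Matrix (Fin n) (Fin n) V} (hA : A ∈ cone n) :
    Pos (quad α A) :=
  MatrixOrdered.compress_mem (fun k _ => α k) hA

theorem quad_unitMat {n : ℕ} (α : Fin n → ℂ) :
    quad α (unitMat V n) = ((∑ k, ‖α k‖ ^ 2 : ℝ) : ℂ) • ordUnit := by
  simp only [quad, unitMat, Matrix.diagonal_apply, smul_ite, smul_zero, Finset.sum_ite_eq,
    Finset.mem_univ, if_true, ← Finset.sum_smul]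
  congr 1
  push_cast
  refine Finset.sum_congr rfl fun k _ => ?_
  exact Complex.conj_mul' (α k)

theorem unitMat_isHermitian (n : ℕ) : (unitMat V n)ᴴ = unitMat V n :=
  MatrixOrdered.isHermitian_of_mem (unitMat_mem n)

theorem isHermitian_of_add_unit {n : ℕ} {A : Matrix (Fin n) (Fin n) V} {r : ℝ}
    (h : (r : ℂ) • unitMat V n + A ∈ cone n) : Aᴴ = A := by
  have h2 := MatrixOrdered.isHermitian_of_mem h
  rw [Matrix.conjTranspose_add, Matrix.conjTranspose_smul, unitMat_isHermitian] at h2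
  simpa using h2

end Basic

/-! ### Unital completely positive maps -/

/-- Unital completely positive maps. -/
structure UCP (V W : Type*) [AddCommGroup V] [Module ℂ V] [StarAddMonoid V] [StarModule ℂ V]
    [MatrixOrdered V] [AddCommGroup W] [Module ℂ W] [StarAddMonoid W] [StarModule ℂ W]
    [MatrixOrdered W] where
  toLin : V →ₗ[ℂ] W
  map_unit : toLin ordUnit = ordUnit
  map_cone : ∀ (n : ℕ) (A : Matrix (Fin n) (Fin n) V), A ∈ cone n → A.map toLin ∈ cone n

namespace UCP

variable {U V W : Type*} [AddCommGroup U] [Module ℂ U] [StarAddMonoid U] [StarModule ℂ U]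
  [MatrixOrdered U] [AddCommGroup V] [Module ℂ V] [StarAddMonoid V] [StarModule ℂ V]
  [MatrixOrdered V] [AddCommGroup W] [Module ℂ W] [StarAddMonoid W] [StarModule ℂ W]
  [MatrixOrdered W]

instance : CoeFun (UCP V W) fun _ => V → W := ⟨fun f => f.toLin⟩

theorem ext {f g : UCP V W} (h : ∀ v, f v = g v) : f = g := by
  obtain ⟨f, _, _⟩ := f
  obtain ⟨g, _, _⟩ := g
  have : f = g := LinearMap.ext h
  subst this
  rfl

theorem map_pos (f : UCP V W) {v : V} (hv : Pos v) : Pos (f v) := f.map_cone 1 _ hv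

theorem map_star (f : UCP V W) (v : V) : f (star v) = star (f v) := by
  have key : ∀ w : V, star w = w → star (f w) = f w := by
    intro w hw
    obtain ⟨r, -, h⟩ := MatrixOrdered.exists_unit_add_mem (V := V) (n := 1)
      (A := fun _ _ => w) (by ext i j; exact hw)
    have h2 := f.map_cone 1 _ h
    have h3 := congrFun (congrFun (MatrixOrdered.isHermitian_of_mem h2) 0) 0
    have h4 : star (f ((r : ℂ) • (Matrix.diagonal fun _ => ordUnit : Matrix (Fin 1) (Fin 1) V) 0 0
        + w)) = f ((r : ℂ) • (Matrix.diagonal fun _ => ordUnit : Matrix (Fin 1) (Fin 1) V) 0 0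
        + w) := h3
    rw [Matrix.diagonal_apply_eq, map_add, map_smul, f.map_unit, star_add, star_smul, star_ordUnit] at h4
    simpa using h4
  have h1 := key (v + star v) (by simp [add_comm])
  have h2 := key (Complex.I • (v - star v)) (by simp [← smul_neg])
  simp only [map_add, map_sub, map_smul, star_add, star_sub, star_smul] at h1 h2
  simp only [Complex.star_def, Complex.conj_I, neg_smul, ← smul_neg] at h2
  have h2 := smul_right_injective W Complex.I_ne_zero h2
  simp only [neg_sub] at h2
  have h3 : (2 : ℂ) • f (star v) = (2 : ℂ) • star (f v) := by
    rw [two_smul, two_smul]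
    have e1 : star (f v) + star (f (star v)) - (star (f (star v)) - star (f v))
      = f v + f (star v) - (f v - f (star v)) := by rw [h1, h2]
    have e2 : star (f v) + star (f (star v)) - (star (f (star v)) - star (f v))
      = star (f v) + star (f v) := by abel
    have e3 : f v + f (star v) - (f v - f (star v)) = f (star v) + f (star v) := by abel
    rw [← e3, ← e1, e2]
  exact smul_right_injective W (two_ne_zero' ℂ) h3

/-- The identity map. -/
def id (V : Type*) [AddCommGroup V] [Module ℂ V] [StarAddMonoid V] [StarModule ℂ V]
    [MatrixOrdered V] : UCP V V where
  toLin := LinearMap.id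
  map_unit := rfl
  map_cone _ _ h := h

/-- The composition `g ∘ f`. -/
def comp (g : UCP V W) (f : UCP U V) : UCP U W where
  toLin := g.toLin ∘ₗ f.toLin
  map_unit := by simp [f.map_unit, g.map_unit]
  map_cone n A h := by simpa [Matrix.map_map] using g.map_cone n _ (f.map_cone n A h)

theorem comp_apply (g : UCP V W) (f : UCP U V) (u : U) : g.comp f u = g (f u) := rfl

theorem cone_zero_mem (n : ℕ) : (0 : Matrix (Fin n) (Fin n) V) ∈ cone n := by
  simpa using MatrixOrdered.smul_mem (r := 0) le_rfl (unitMat_mem (V := V) n)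

theorem cone_sum_mem {ι : Type*} (s : Finset ι) {n : ℕ} (A : ι → Matrix (Fin n) (Fin n) V)
    (h : ∀ i ∈ s, A i ∈ cone n) : ∑ i ∈ s, A i ∈ cone n := by
  classical
  induction s using Finset.induction_on with
  | empty => simpa using cone_zero_mem n
  | insert a s ha ih =>
    rw [Finset.sum_insert ha]
    exact MatrixOrdered.add_mem (h a (by simp)) (ih fun i hi => h i (by simp [hi]))

/-- The average `(1/d) (f₁ + ⋯ + f_d)` of finitely many unital completely positive maps. -/
def average {d : ℕ} [NeZero d] (f : Fin d → UCP V W) : UCP V W where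
  toLin := (((d : ℝ)⁻¹ : ℝ) : ℂ) • ∑ k, (f k).toLin
  map_unit := by
    have hd : (d : ℂ) ≠ 0 := Nat.cast_ne_zero.2 (NeZero.ne d)
    simp only [LinearMap.smul_apply, LinearMap.sum_apply, (f _).map_unit, Finset.sum_const,
      Finset.card_univ, Fintype.card_fin]
    rw [← Nat.cast_smul_eq_nsmul ℂ, smul_smul]
    push_cast
    rw [inv_mul_cancel₀ hd, one_smul]
  map_cone n A h := by
    have : A.map ((((d : ℝ)⁻¹ : ℝ) : ℂ) • ∑ k, (f k).toLin)
        = (((d : ℝ)⁻¹ : ℝ) : ℂ) • ∑ k, A.map (f k).toLin := by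
      ext i j
      simp [Matrix.sum_apply]
    rw [this]
    exact MatrixOrdered.smul_mem (by positivity) (cone_sum_mem _ _ fun k _ => (f k).map_cone n A h)

end UCP

/-! ### Archimedeanization -/

section Arch

variable (V : Type*) [AddCommGroup V] [Module ℂ V] [StarAddMonoid V] [StarModule ℂ V]
  [MatrixOrdered V]

/-- The null elements: those `v` such that `Re(c v) ≥ -r e` for all scalars `c` and all `r > 0`. -/
def nullSpace : Submodule ℂ V where
  carrier := {v | ∀ (c : ℂ) (r : ℝ), 0 < r → Pos ((r : ℂ) • ordUnit + (c • v + star (c • v)))}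
  zero_mem' c r hr := by simpa using pos_unit.smul hr.le
  add_mem' {v w} hv hw c r hr := by
    have h := (hv c (r / 2) (by positivity)).add (hw c (r / 2) (by positivity))
    convert h using 1
    simp only [smul_add, star_add]
    have : (r : ℂ) • (ordUnit : V) = ((r / 2 : ℝ) : ℂ) • ordUnit + ((r / 2 : ℝ) : ℂ) • ordUnit := by
      rw [← add_smul]
      push_cast
      ring_nf
    rw [this]
    abel
  smul_mem' a v hv c r hr := by
    simpa [smul_smul] using hv (c * a) r hr

theorem star_mem_nullSpace {v : V} (hv : v ∈ nullSpace V) : star v ∈ nullSpace V := by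
  intro c r hr
  have := hv (star c) r hr
  simpa [star_smul, add_comm] using this

/-- The Archimedeanization of a matricially ordered space: the quotient by the null elements, with
the Archimedean closures of the images of the cones. -/
def Archimedeanization : Type _ := V ⧸ nullSpace V

namespace Archimedeanization

instance : AddCommGroup (Archimedeanization V) :=
  inferInstanceAs (AddCommGroup (V ⧸ nullSpace V))

instance : Module ℂ (Archimedeanization V) := inferInstanceAs (Module ℂ (V ⧸ nullSpace V))

/-- The quotient map. -/
def mk : V →ₗ[ℂ] Archimedeanization V := (nullSpace V).mkQ

theorem mk_surjective : Function.Surjective (mk V) := (nullSpace V).mkQ_surjective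

theorem mk_eq_zero_iff {v : V} : mk V v = 0 ↔ v ∈ nullSpace V :=
  Submodule.Quotient.mk_eq_zero _

instance : Star (Archimedeanization V) :=
  ⟨(nullSpace V).mapQ (nullSpace V) (starLinearEquiv ℂ : V ≃ₗ⋆[ℂ] V).toLinearMap
    fun _ hv => star_mem_nullSpace V hv⟩

theorem star_mk (v : V) : star (mk V v) = mk V (star v) := rfl

instance : StarAddMonoid (Archimedeanization V) where
  star_involutive x := by
    obtain ⟨v, rfl⟩ := mk_surjective V x
    simp [star_mk]
  star_add x y := by
    obtain ⟨v, rfl⟩ := mk_surjective V x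
    obtain ⟨w, rfl⟩ := mk_surjective V y
    rw [← map_add, star_mk, star_mk, star_mk, star_add, map_add]

instance : StarModule ℂ (Archimedeanization V) where
  star_smul c x := by
    obtain ⟨v, rfl⟩ := mk_surjective V x
    rw [← map_smul, star_mk, star_mk, star_smul, map_smul]

theorem conjTranspose_map_mk {n : ℕ} (A : Matrix (Fin n) (Fin n) V) :
    (A.map (mk V))ᴴ = Aᴴ.map (mk V) := by
  ext i j
  simp [star_mk]

theorem map_mk_surjective {n : ℕ} (A : Matrix (Fin n) (Fin n) (Archimedeanization V)) :
    ∃ u : Matrix (Fin n) (Fin n) V, u.map (mk V) = A := by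
  choose g hg using mk_surjective V
  exact ⟨A.map g, by ext i j; simp [hg]⟩

theorem map_mk_add {n : ℕ} (A B : Matrix (Fin n) (Fin n) V) :
    (A + B).map (mk V) = A.map (mk V) + B.map (mk V) := by
  ext i j
  simp

theorem map_mk_smul {n : ℕ} (c : ℂ) (A : Matrix (Fin n) (Fin n) V) :
    (c • A).map (mk V) = c • A.map (mk V) := by
  ext i j
  simp

theorem map_mk_unitMat {n : ℕ} :
    (unitMat V n).map (mk V) = Matrix.diagonal fun _ => mk V ordUnit := by
  ext i j
  simp [unitMat, Matrix.diagonal_apply, apply_ite (mk V)]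

instance : MatrixOrdered (Archimedeanization V) where
  ordUnit := mk V ordUnit
  cone n := {A | ∀ r : ℝ, 0 < r → ∃ u : Matrix (Fin n) (Fin n) V,
    u.map (mk V) = A ∧ (r : ℂ) • unitMat V n + u ∈ cone n}
  isHermitian_of_mem {n A} hA := by
    obtain ⟨u, rfl, hu⟩ := hA 1 one_pos
    rw [conjTranspose_map_mk, isHermitian_of_add_unit hu]
  add_mem {n A B} hA hB r hr := by
    obtain ⟨u, rfl, hu⟩ := hA (r / 2) (by positivity)
    obtain ⟨w, rfl, hw⟩ := hB (r / 2) (by positivity)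
    refine ⟨u + w, map_mk_add V u w, ?_⟩
    convert MatrixOrdered.add_mem hu hw using 1
    have : (r : ℂ) • unitMat V n
        = ((r / 2 : ℝ) : ℂ) • unitMat V n + ((r / 2 : ℝ) : ℂ) • unitMat V n := by
      rw [← add_smul]
      push_cast
      ring_nf
    rw [this]
    abel
  smul_mem {n A s} hs hA r hr := by
    obtain ⟨u, rfl, hu⟩ := hA (r / (s + 1)) (by positivity)
    refine ⟨(s : ℂ) • u, map_mk_smul V _ u, ?_⟩
    have h1 := MatrixOrdered.smul_mem hs hu
    have h2 := MatrixOrdered.smul_mem (r := r - s * (r / (s + 1)))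
      (by
        have : r - s * (r / (s + 1)) = r / (s + 1) := by field_simp; ring
        rw [this]; positivity) (unitMat_mem (V := V) n)
    convert MatrixOrdered.add_mem h2 h1 using 1
    rw [smul_add, smul_smul, ← add_assoc, ← add_smul]
    push_cast
    ring_nf
  compress_mem {n m A} α hA r hr := by
    obtain ⟨t, ht, h2⟩ := MatrixOrdered.exists_unit_add_mem (V := V) (n := m)
      (A := -compress α (unitMat V n))
      (by rw [Matrix.conjTranspose_neg, conjTranspose_compress, unitMat_isHermitian])
    obtain ⟨u, rfl, hu⟩ := hA (r / t) (by positivity)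
    refine ⟨compress α u, (compress_map _ _ _).symm, ?_⟩
    have h1 := MatrixOrdered.compress_mem α hu
    have h3 := MatrixOrdered.smul_mem (r := r / t) (by positivity) h2
    convert MatrixOrdered.add_mem h3 h1 using 1
    rw [compress_add, compress_smul, smul_add, smul_neg, smul_smul, ← Complex.ofReal_mul,
      div_mul_cancel₀ _ ht.ne']
    simp only [unitMat]
    abel
  exists_unit_add_mem {n A} hA := by
    obtain ⟨u, rfl⟩ := map_mk_surjective V A
    obtain ⟨t, ht, h⟩ := MatrixOrdered.exists_unit_add_mem (V := V) (n := n)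
      (A := (1 / 2 : ℂ) • (u + uᴴ)) (by simp [Matrix.conjTranspose_smul, add_comm])
    refine ⟨t, ht, fun r hr => ⟨(t : ℂ) • unitMat V n + (1 / 2 : ℂ) • (u + uᴴ), ?_, ?_⟩⟩
    · rw [map_mk_add, map_mk_smul, map_mk_smul, map_mk_add, ← conjTranspose_map_mk, hA,
        map_mk_unitMat, ← two_smul ℂ, smul_smul]
      norm_num
    · exact MatrixOrdered.add_mem (MatrixOrdered.smul_mem hr.le (unitMat_mem n)) h

theorem mk_ordUnit : mk V ordUnit = ordUnit := rfl

theorem mem_cone_iff {n : ℕ} {A : Matrix (Fin n) (Fin n) (Archimedeanization V)} :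
    A ∈ cone n ↔ ∀ r : ℝ, 0 < r → ∃ u : Matrix (Fin n) (Fin n) V,
      u.map (mk V) = A ∧ (r : ℂ) • unitMat V n + u ∈ cone n := Iff.rfl

theorem map_mk_unitMat_eq (n : ℕ) :
    (unitMat V n).map (mk V) = unitMat (Archimedeanization V) n := map_mk_unitMat V

variable {V} in
theorem mem_cone_of_mem {n : ℕ} {u : Matrix (Fin n) (Fin n) V} (hu : u ∈ cone n) :
    u.map (mk V) ∈ cone n := fun _ hr =>
  ⟨u, rfl, MatrixOrdered.add_mem (MatrixOrdered.smul_mem hr.le (unitMat_mem n)) hu⟩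

instance : OperatorSystem (Archimedeanization V) where
  eq_zero_of_mem_neg_mem {n A} hA hA' := by
    ext i j
    obtain ⟨v, hv⟩ := mk_surjective V (A i j)
    rw [Matrix.zero_apply, ← hv, mk_eq_zero_iff]
    intro c r hr
    set α : Fin n → ℂ := Pi.single i 1 + c • Pi.single j 1 with hα
    set β : Fin n → ℂ := Pi.single i 1 - c • Pi.single j 1 with hβ
    set K : ℝ := ∑ k, ‖α k‖ ^ 2 with hK
    set L : ℝ := ∑ k, ‖β k‖ ^ 2 with hL
    have hK0 : 0 ≤ K := Finset.sum_nonneg fun _ _ => by positivity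
    have hL0 : 0 ≤ L := Finset.sum_nonneg fun _ _ => by positivity
    set δ : ℝ := r / (K + L + 1) with hδ
    have hδ0 : 0 < δ := by positivity
    obtain ⟨u, hu, hu'⟩ := hA δ hδ0
    obtain ⟨w, hw, hw'⟩ := hA' δ hδ0
    have p1 := pos_quad α hu'
    have p2 := pos_quad β hw'
    have q1 : star (quad α u) = quad α u := by
      have := p1.star_eq
      rw [quad_add, quad_smul, quad_unitMat] at this
      simpa [star_ordUnit] using this
    have q2 : star (quad β w) = quad β w := by
      have := p2.star_eq
      rw [quad_add, quad_smul, quad_unitMat] at this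
      simpa [star_ordUnit] using this
    have hAh := MatrixOrdered.isHermitian_of_mem hA
    have hji : A j i = star (A i j) := by
      rw [← Matrix.conjTranspose_apply, hAh]
    set s : V := c • v + star (c • v) - (1 / 2 : ℂ) • (quad α u + quad β w) with hs
    have hsN : s ∈ nullSpace V := by
      rw [← mk_eq_zero_iff, hs, map_sub, map_smul, map_add (mk V) (quad α u), ← quad_map,
        ← quad_map, hu, hw]
      have hneg : quad β (-A) = -quad β A := by
        have := quad_smul β (-1) A
        simpa using this
      have hp := quad_polarization i j c A
      rw [hneg, ← sub_eq_add_neg, hp, smul_smul, map_add, ← star_mk, map_smul, hv, hji, star_smul]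
      norm_num
    have hss : star s = s := by
      have h12 : star (1 / 2 : ℂ) = 1 / 2 := by simp
      rw [hs]
      simp only [star_sub, star_add, star_smul, q1, q2, star_star, h12]
      abel
    have p3 := hsN (1 / 2) (r / 2) (by positivity)
    have h2s : (1 / 2 : ℂ) • s + star ((1 / 2 : ℂ) • s) = s := by
      rw [star_smul, hss]
      simp only [one_div, star_inv₀, star_ofNat, ← add_smul]
      norm_num
    rw [h2s] at p3
    have p4 := (p1.add p2).smul (r := 1 / 2) (by norm_num)
    have hcoef : 0 ≤ r / 2 - δ * (K + L) / 2 := by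
      have : δ * (K + L) ≤ r := by
        rw [hδ, div_mul_eq_mul_div, div_le_iff₀ (by positivity)]
        nlinarith
      linarith
    have p5 := (pos_unit (V := V)).smul hcoef
    convert (p3.add p4).add p5 using 1
    rw [quad_add, quad_smul, quad_unitMat, quad_add, quad_smul, quad_unitMat, hs]
    simp only [← hK, ← hL]
    push_cast
    module
  archimedean {n A} hA r hr := by
    obtain ⟨u, hu, hu'⟩ := hA (r / 2) (by positivity) (r / 2) (by positivity)
    refine ⟨u - ((r / 2 : ℝ) : ℂ) • unitMat V n, ?_, ?_⟩
    · have : u - ((r / 2 : ℝ) : ℂ) • unitMat V n = u + (-((r / 2 : ℝ) : ℂ)) • unitMat V n := by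
        rw [neg_smul, sub_eq_add_neg]
      rw [this, map_mk_add, map_mk_smul, hu, map_mk_unitMat_eq]
      module
    · convert hu' using 1
      push_cast
      module

end Archimedeanization

end Arch

section OpSysBasic

variable {R : Type*} [AddCommGroup R] [Module ℂ R] [StarAddMonoid R] [StarModule ℂ R]
  [OperatorSystem R]

theorem eq_zero_of_pos {v : R} (h : Pos v) (h' : Pos (-v)) : v = 0 :=
  congrFun (congrFun (OperatorSystem.eq_zero_of_mem_neg_mem (n := 1) h h') 0) 0

theorem unitMat_one (V : Type*) [AddCommGroup V] [Module ℂ V] [StarAddMonoid V] [StarModule ℂ V]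
    [MatrixOrdered V] : unitMat V 1 = fun _ _ => ordUnit := by
  ext i j
  simp [unitMat, Subsingleton.elim i j]

theorem pos_of_archimedean {v : R} (h : ∀ r : ℝ, 0 < r → Pos ((r : ℂ) • ordUnit + v)) :
    Pos v := by
  refine OperatorSystem.archimedean fun r hr => ?_
  rw [unitMat_one]
  exact h r hr

end OpSysBasic

namespace Archimedeanization

variable {V R : Type*} [AddCommGroup V] [Module ℂ V] [StarAddMonoid V] [StarModule ℂ V]
  [MatrixOrdered V] [AddCommGroup R] [Module ℂ R] [StarAddMonoid R] [StarModule ℂ R]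
  [OperatorSystem R]

theorem nullSpace_le_ker (f : UCP V R) : nullSpace V ≤ LinearMap.ker f.toLin := by
  intro v hv
  rw [LinearMap.mem_ker]
  have key : ∀ c : ℂ, f (c • v + star (c • v)) = 0 := by
    have pos : ∀ c : ℂ, Pos (f (c • v + star (c • v))) := by
      refine fun c => pos_of_archimedean fun r hr => ?_
      have := f.map_pos (hv c r hr)
      rwa [map_add, map_smul, f.map_unit] at this
    intro c
    refine eq_zero_of_pos (pos c) ?_
    have := pos (-c)
    rwa [neg_smul, star_neg, ← neg_add, map_neg] at this
  have h1 := key 1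
  have h2 := key Complex.I
  simp only [one_smul, map_add, star_smul, Complex.star_def, Complex.conj_I, map_smul] at h1 h2
  rw [neg_smul, ← smul_neg, ← smul_add] at h2
  have h2 := (smul_eq_zero.1 h2).resolve_left Complex.I_ne_zero
  have h3 : (2 : ℂ) • f v = 0 := by
    have : (2 : ℂ) • f v = (f v + f (star v)) + (f v + -f (star v)) := by
      rw [two_smul]
      abel
    rw [this, h1, h2, add_zero]
  exact (smul_eq_zero.1 h3).resolve_left two_ne_zero

/-- A unital completely positive map into an operator system factors through the
Archimedeanization. -/
def lift (f : UCP V R) : UCP (Archimedeanization V) R where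
  toLin := (nullSpace V).liftQ f.toLin (nullSpace_le_ker f)
  map_unit := f.map_unit
  map_cone n A hA := by
    refine OperatorSystem.archimedean fun r hr => ?_
    obtain ⟨u, rfl, hu⟩ := hA r hr
    convert f.map_cone n _ hu using 1
    ext i j
    by_cases hij : i = j
    · subst hij
      simp only [unitMat, Matrix.add_apply, Matrix.smul_apply, Matrix.diagonal_apply_eq,
        Matrix.map_apply, map_add, map_smul, f.map_unit]
      rfl
    · simp only [unitMat, Matrix.add_apply, Matrix.smul_apply, Matrix.diagonal_apply_ne _ hij,
        Matrix.map_apply, smul_zero, zero_add]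
      rfl

theorem lift_mk (f : UCP V R) (v : V) : lift f (mk V v) = f v := rfl

end Archimedeanization

/-! ### Coproducts of operator systems -/

section Coproduct

variable {I : Type*} [Fintype I] (S : I → Type*) [∀ i, AddCommGroup (S i)] [∀ i, Module ℂ (S i)]
  [∀ i, StarAddMonoid (S i)] [∀ i, StarModule ℂ (S i)]

/-- The direct sum of the underlying spaces. -/
def PreCoproduct : Type _ := ∀ i, S i

instance : AddCommGroup (PreCoproduct S) := inferInstanceAs (AddCommGroup (∀ i, S i))
instance : Module ℂ (PreCoproduct S) := inferInstanceAs (Module ℂ (∀ i, S i))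
instance : StarAddMonoid (PreCoproduct S) := inferInstanceAs (StarAddMonoid (∀ i, S i))
instance : StarModule ℂ (PreCoproduct S) := inferInstanceAs (StarModule ℂ (∀ i, S i))

namespace PreCoproduct

/-- The coordinate projections. -/
def proj (i : I) : PreCoproduct S →ₗ[ℂ] S i := (LinearMap.proj i : (∀ i, S i) →ₗ[ℂ] S i)

open Classical in
/-- The coordinate inclusions. -/
def single (i : I) : S i →ₗ[ℂ] PreCoproduct S := LinearMap.single ℂ S i

variable {S} in
theorem ext {u v : PreCoproduct S} (h : ∀ i, proj S i u = proj S i v) : u = v := funext h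

theorem proj_star (i : I) (u : PreCoproduct S) : proj S i (star u) = star (proj S i u) := rfl

theorem proj_single_self (i : I) (u : S i) : proj S i (single S i u) = u := by
  classical
  exact Pi.single_eq_same i u

theorem proj_single_of_ne {i j : I} (h : i ≠ j) (u : S i) : proj S j (single S i u) = 0 := by
  classical
  exact Pi.single_eq_of_ne h.symm u

theorem sum_single (u : PreCoproduct S) : u = ∑ i, single S i (proj S i u) := by
  classical
  exact (Finset.univ_sum_single (u : ∀ i, S i)).symm

end PreCoproduct

open PreCoproduct (proj single proj_star proj_single_self proj_single_of_ne)

variable [∀ i, OperatorSystem (S i)]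

/-- The tuple `(e₁, …, e_d) / d`. -/
def PreCoproduct.unit : PreCoproduct S := fun _ => ((Fintype.card I : ℂ)⁻¹) • ordUnit

theorem PreCoproduct.proj_unit (i : I) :
    proj S i (PreCoproduct.unit S) = ((Fintype.card I : ℂ)⁻¹) • ordUnit := rfl

/-- The direct sum, in which tuples `(cᵢ eᵢ)ᵢ` with scalars `cᵢ` of sum zero are to be neglected:
a hermitian matrix is in the cone if, after the addition of such a tuple (with hermitian scalar
matrices `cᵢ`), all its components are in the cones of the summands.  The unit is
`(e₁, …, e_d) / d`, which represents each of the elements `(0, …, 0, eᵢ, 0, …, 0)`. -/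
instance : MatrixOrdered (PreCoproduct S) where
  ordUnit := PreCoproduct.unit S
  cone n := {A | ∃ c : I → Matrix (Fin n) (Fin n) ℂ, (∀ i, (c i)ᴴ = c i) ∧ ∑ i, c i = 0 ∧
    ∀ i, A.map (proj S i) + (c i).map (fun z => z • (ordUnit : S i)) ∈ cone n}
  isHermitian_of_mem {n A} := by
    rintro ⟨c, hc, -, h⟩
    ext k l
    refine PreCoproduct.ext fun i => ?_
    have h1 := congrFun (congrFun (MatrixOrdered.isHermitian_of_mem (h i)) k) l
    have h2 := congrFun (congrFun (hc i) k) l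
    simp only [Matrix.conjTranspose_apply, Matrix.add_apply, Matrix.map_apply, star_add, star_smul,
      star_ordUnit] at h1 h2
    rw [h2] at h1
    exact (proj_star S i _).trans (add_right_cancel h1)
  add_mem {n A B} := by
    rintro ⟨c, hc, hc0, h⟩ ⟨c', hc', hc0', h'⟩
    refine ⟨c + c', fun i => by simp [hc, hc'], by simp [Finset.sum_add_distrib, hc0, hc0'],
      fun i => ?_⟩
    convert MatrixOrdered.add_mem (h i) (h' i) using 1
    ext k l
    simp only [Matrix.add_apply, Matrix.map_apply, Pi.add_apply, add_smul, map_add]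
    abel
  smul_mem {n A r} hr := by
    rintro ⟨c, hc, hc0, h⟩
    refine ⟨(r : ℂ) • c, fun i => by simp [hc, Matrix.conjTranspose_smul],
      by simp [← Finset.smul_sum, hc0], fun i => ?_⟩
    convert MatrixOrdered.smul_mem hr (h i) using 1
    ext k l
    simp only [Matrix.add_apply, Matrix.map_apply, Matrix.smul_apply, Pi.smul_apply, smul_add, map_smul,
      smul_assoc]
  compress_mem {n m A} α := by
    rintro ⟨c, hc, hc0, h⟩
    refine ⟨fun i => compress α (c i), fun i => by rw [conjTranspose_compress, hc], ?_,
      fun i => ?_⟩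
    · ext k l
      have : ∀ a b, ∑ i, c i a b = 0 := fun a b => by
        have := congrFun (congrFun hc0 a) b
        simpa [Matrix.sum_apply] using this
      simp only [Matrix.sum_apply, compress, Matrix.zero_apply]
      rw [Finset.sum_comm]
      refine Finset.sum_eq_zero fun a _ => ?_
      rw [Finset.sum_comm]
      refine Finset.sum_eq_zero fun b _ => ?_
      rw [← Finset.smul_sum, this, smul_zero]
    · convert MatrixOrdered.compress_mem α (h i) using 1
      rw [compress_add]
      congr 1
      · exact (compress_map (proj S i) α A).symm
      · exact (compress_map (LinearMap.toSpanSingleton ℂ (S i) ordUnit) α (c i)).symm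
  exists_unit_add_mem {n A} hA := by
    have h : ∀ i, ∃ r : ℝ, 0 < r ∧
        (r : ℂ) • Matrix.diagonal (fun _ => (ordUnit : S i)) + A.map (proj S i) ∈ cone n := by
      intro i
      refine MatrixOrdered.exists_unit_add_mem ?_
      ext k l
      rw [Matrix.conjTranspose_apply, Matrix.map_apply, ← proj_star, ← Matrix.conjTranspose_apply,
        hA, Matrix.map_apply]
    choose r hr h using h
    refine ⟨(Fintype.card I : ℝ) * ∑ i, r i + 1, ?_, 0, by simp, by simp, fun i => ?_⟩
    · have : 0 ≤ ∑ i, r i := Finset.sum_nonneg fun i _ => (hr i).le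
      positivity
    have hcard : 0 < (Fintype.card I : ℝ) := by
      have : Nonempty I := ⟨i⟩
      exact_mod_cast Fintype.card_pos
    have hle : 0 ≤ (∑ i, r i + (Fintype.card I : ℝ)⁻¹) - r i := by
      have := Finset.single_le_sum (f := r) (fun i _ => (hr i).le) (Finset.mem_univ i)
      have : 0 < (Fintype.card I : ℝ)⁻¹ := by positivity
      linarith
    convert MatrixOrdered.add_mem (MatrixOrdered.smul_mem hle (unitMat_mem (V := S i) n)) (h i)
      using 1
    have hc : (Fintype.card I : ℂ) ≠ 0 := by exact_mod_cast hcard.ne'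
    have e1 : (((Fintype.card I : ℝ) * ∑ i, r i + 1 : ℝ) : ℂ) * (Fintype.card I : ℂ)⁻¹
        = ((∑ i, r i + (Fintype.card I : ℝ)⁻¹ : ℝ) : ℂ) := by
      push_cast
      field_simp
    ext k l
    by_cases hkl : k = l
    · subst hkl
      simp only [unitMat, Matrix.add_apply, Matrix.map_apply, Matrix.smul_apply,
        Matrix.diagonal_apply_eq, Pi.zero_apply, Matrix.zero_apply, zero_smul, add_zero, map_add,
        map_smul, PreCoproduct.proj_unit]
      rw [smul_smul, e1, ← add_assoc, ← add_smul]
      push_cast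
      congr 2
      ring
    · simp only [unitMat, Matrix.add_apply, Matrix.map_apply, Matrix.smul_apply,
        Matrix.diagonal_apply_ne _ hkl, Pi.zero_apply, Matrix.zero_apply, zero_smul, add_zero,
        smul_zero, zero_add]

theorem PreCoproduct.proj_ordUnit (i : I) :
    proj S i ordUnit = ((Fintype.card I : ℂ)⁻¹) • ordUnit := rfl

/-- The coproduct `S₁ ⊕₁ ⋯ ⊕₁ S_d` of finitely many operator systems. -/
abbrev Coproduct : Type _ := Archimedeanization (PreCoproduct S)

namespace Coproduct

theorem mk_single_unit [Nonempty I] (i : I) :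
    Archimedeanization.mk (PreCoproduct S) (single S i ordUnit) = ordUnit := by
  classical
  rw [← Archimedeanization.mk_ordUnit, ← sub_eq_zero, ← map_sub,
    Archimedeanization.mk_eq_zero_iff]
  intro c r hr
  refine (pos_unit.smul hr.le).add ?_
  set d : I → ℂ := fun j => (if i = j then 1 else 0) - (Fintype.card I : ℂ)⁻¹ with hd
  have hcard : (Fintype.card I : ℂ) ≠ 0 := by exact_mod_cast Fintype.card_ne_zero
  have hd0 : ∑ j, d j = 0 := by
    simp [hd, Finset.sum_sub_distrib]
  have hds : ∀ j, star (d j) = d j := by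
    intro j
    simp only [hd, star_sub, apply_ite star, star_one, star_zero, star_inv₀, star_natCast]
  refine ⟨fun j => Matrix.of fun _ _ => -((c + star c) * d j), ?_, ?_, ?_⟩
  · intro j
    ext k l
    simp only [Matrix.conjTranspose_apply, Matrix.of_apply, star_neg, star_mul, star_add, star_star, hds]
    ring
  · ext k l
    simp only [Matrix.sum_apply, Matrix.of_apply, Finset.sum_neg_distrib, ← Finset.mul_sum, hd0]
    simp
  · intro j
    convert UCP.cone_zero_mem 1 using 1
    ext k l
    have e : proj S j (single S i ordUnit - ordUnit) = d j • (ordUnit : S j) := by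
      by_cases hij : i = j
      · subst hij
        rw [map_sub, proj_single_self, PreCoproduct.proj_ordUnit]
        simp [hd, sub_smul]
      · rw [map_sub, proj_single_of_ne S hij, PreCoproduct.proj_ordUnit]
        simp [hd, hij]
    change proj S j (c • (single S i ordUnit - ordUnit)
      + star (c • (single S i ordUnit - ordUnit))) + (-((c + star c) * d j)) • (ordUnit : S j) = 0
    rw [map_add, proj_star, map_smul]
    rw [e, star_smul, star_smul, hds, star_ordUnit]
    module

/-- The canonical map `ιᵢ` of the `i`-th operator system into the coproduct. -/
def ι [Nonempty I] (i : I) : UCP (S i) (Coproduct S) where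
  toLin := Archimedeanization.mk (PreCoproduct S) ∘ₗ single S i
  map_unit := mk_single_unit S i
  map_cone n A hA := by
    have h : A.map (single S i) ∈ cone n := by
      refine ⟨0, by simp, by simp, fun j => ?_⟩
      by_cases hij : i = j
      · subst hij
        convert hA using 1
        ext k l
        simp [proj_single_self]
      · convert UCP.cone_zero_mem n using 1
        ext k l
        simp [proj_single_of_ne S hij]
    exact Archimedeanization.mem_cone_of_mem h

variable {S} {R : Type*} [AddCommGroup R] [Module ℂ R] [StarAddMonoid R] [StarModule ℂ R]
  [OperatorSystem R]

/-- The map `(uᵢ)ᵢ ↦ ∑ φᵢ(uᵢ)` before passing to the quotient. -/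
def preDesc [Nonempty I] (φ : ∀ i, UCP (S i) R) : UCP (PreCoproduct S) R where
  toLin := ∑ i, (φ i).toLin ∘ₗ proj S i
  map_unit := by
    have hcard : (Fintype.card I : ℂ) ≠ 0 := by exact_mod_cast Fintype.card_ne_zero
    rw [LinearMap.sum_apply]
    simp only [LinearMap.comp_apply, PreCoproduct.proj_ordUnit, map_smul, (φ _).map_unit, Finset.sum_const, Finset.card_univ]
    rw [← Nat.cast_smul_eq_nsmul ℂ, smul_smul, mul_inv_cancel₀ hcard, one_smul]
  map_cone n A := by
    rintro ⟨c, -, hc0, h⟩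
    have h2 := UCP.cone_sum_mem Finset.univ _ fun i _ => (φ i).map_cone n _ (h i)
    convert h2 using 1
    ext k l
    have hc : ∑ i, c i k l = 0 := by
      have := congrFun (congrFun hc0 k) l
      simpa [Matrix.sum_apply] using this
    simp only [Matrix.sum_apply, Matrix.map_apply, Matrix.add_apply, map_add, map_smul,
      (φ _).map_unit, Finset.sum_add_distrib, ← Finset.sum_smul, hc, zero_smul, add_zero,
      LinearMap.sum_apply, LinearMap.comp_apply]

/-- The unital completely positive map on the coproduct with prescribed restrictions. -/
def desc [Nonempty I] (φ : ∀ i, UCP (S i) R) : UCP (Coproduct S) R :=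
  Archimedeanization.lift (preDesc φ)

theorem desc_ι [Nonempty I] (φ : ∀ i, UCP (S i) R) (i : I) (u : S i) :
    desc φ (ι S i u) = φ i u := by
  change (∑ j, (φ j).toLin ∘ₗ proj S j) (single S i u) = _
  rw [LinearMap.sum_apply, Finset.sum_eq_single i]
  · simp [proj_single_self]
  · intro j _ hj
    simp [proj_single_of_ne S hj.symm]
  · simp

theorem hom_ext [Nonempty I] {f g : UCP (Coproduct S) R}
    (h : ∀ i u, f (ι S i u) = g (ι S i u)) : f = g := by
  refine UCP.ext fun x => ?_
  obtain ⟨v, rfl⟩ := Archimedeanization.mk_surjective _ x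
  have hv : Archimedeanization.mk (PreCoproduct S) v = ∑ i, ι S i (proj S i v) := by
    conv_lhs => rw [PreCoproduct.sum_single S v, map_sum]
    rfl
  rw [hv, map_sum, map_sum]
  exact Finset.sum_congr rfl fun i _ => h i _

/-- The universal property of the coproduct. -/
theorem existsUnique [Nonempty I] (φ : ∀ i, UCP (S i) R) :
    ∃! f : UCP (Coproduct S) R, ∀ i u, f (ι S i u) = φ i u :=
  ⟨desc φ, desc_ι φ, fun _ hg => hom_ext fun i u => (hg i u).trans (desc_ι φ i u).symm⟩

/-- The map `⊕̇ ψᵢ` between coproducts that is induced by maps `ψᵢ` of the summands. -/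
def map {T : I → Type*} [∀ i, AddCommGroup (T i)] [∀ i, Module ℂ (T i)]
    [∀ i, StarAddMonoid (T i)] [∀ i, StarModule ℂ (T i)] [∀ i, OperatorSystem (T i)] [Nonempty I]
    (ψ : ∀ i, UCP (S i) (T i)) : UCP (Coproduct S) (Coproduct T) :=
  desc fun i => (ι T i).comp (ψ i)

end Coproduct

/-- In a coproduct of copies of one operator system, the canonical maps are complete order
embeddings. -/
theorem Coproduct.ι_embedding {I : Type*} [Fintype I] [Nonempty I] (T : Type*) [AddCommGroup T]
    [Module ℂ T] [StarAddMonoid T] [StarModule ℂ T] [OperatorSystem T] (i : I) :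
    Function.Injective (Coproduct.ι (fun _ : I => T) i) ∧
      ∀ (n : ℕ) (A : Matrix (Fin n) (Fin n) T),
        A.map (Coproduct.ι (fun _ : I => T) i) ∈ cone n ↔ A ∈ cone n := by
  set fold : UCP (Coproduct fun _ : I => T) T := Coproduct.desc fun _ => UCP.id T
  have h : ∀ t : T, fold (Coproduct.ι (fun _ : I => T) i t) = t :=
    fun t => Coproduct.desc_ι (S := fun _ : I => T) (fun _ => UCP.id T) i t
  refine ⟨fun s t hst => by rw [← h s, hst, h t], fun n A => ⟨fun hA => ?_, fun hA => ?_⟩⟩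
  · have := fold.map_cone n _ hA
    rw [Matrix.map_map] at this
    convert this using 1
    ext k l
    exact (h _).symm
  · exact (Coproduct.ι (fun _ : I => T) i).map_cone n A hA

end Coproduct

/-! ### Inductive limits of operator systems -/

section InductiveLimit

variable {S : ℕ → Type*} [∀ n, AddCommGroup (S n)] [∀ n, Module ℂ (S n)]
  [∀ n, StarAddMonoid (S n)] [∀ n, StarModule ℂ (S n)] [∀ n, OperatorSystem (S n)]
  (φ : ∀ n, UCP (S n) (S (n + 1)))

/-- The sequences `(uₙ)` with `uₙ₊₁ = φₙ(uₙ)` for all sufficiently large `n`. -/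
def coherentSequences : Submodule ℂ (∀ n, S n) where
  carrier := {u | ∀ᶠ n in atTop, u (n + 1) = φ n (u n)}
  zero_mem' := by simp
  add_mem' {u v} hu hv := by
    filter_upwards [hu, hv] with n h1 h2
    simp [h1, h2]
  smul_mem' c u hu := by
    filter_upwards [hu] with n h1
    simp [h1]

/-- The coherent sequences, as a matricially ordered space.  Two sequences that agree eventually
will be identified in the limit. -/
def PreLimit : Type _ := coherentSequences φ

namespace PreLimit

instance : AddCommGroup (PreLimit φ) := inferInstanceAs (AddCommGroup (coherentSequences φ))
instance : Module ℂ (PreLimit φ) := inferInstanceAs (Module ℂ (coherentSequences φ))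

/-- The `n`-th term of a sequence. -/
def term (n : ℕ) : PreLimit φ →ₗ[ℂ] S n :=
  (LinearMap.proj n : (∀ n, S n) →ₗ[ℂ] S n) ∘ₗ (coherentSequences φ).subtype

variable {φ} in
theorem ext {u v : PreLimit φ} (h : ∀ n, term φ n u = term φ n v) : u = v :=
  Subtype.ext (funext h)

theorem eventually_coherent (u : PreLimit φ) :
    ∀ᶠ n in atTop, term φ (n + 1) u = φ n (term φ n u) := u.2

/-- A coherent sequence from its terms. -/
def ofTerms (u : ∀ n, S n) (hu : ∀ᶠ n in atTop, u (n + 1) = φ n (u n)) : PreLimit φ := ⟨u, hu⟩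

theorem term_ofTerms (u : ∀ n, S n) (hu) (n : ℕ) : term φ n (ofTerms φ u hu) = u n := rfl

instance : Star (PreLimit φ) := ⟨fun u => ofTerms φ (fun n => star (term φ n u)) (by
  filter_upwards [eventually_coherent φ u] with n h
  rw [h, UCP.map_star])⟩

theorem term_star (n : ℕ) (u : PreLimit φ) : term φ n (star u) = star (term φ n u) := rfl

instance : StarAddMonoid (PreLimit φ) where
  star_involutive u := ext fun n => by simp [term_star]
  star_add u v := ext fun n => by simp [term_star]

instance : StarModule ℂ (PreLimit φ) where
  star_smul c u := ext fun n => by simp [term_star]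

theorem map_term_succ {k : ℕ} (A : Matrix (Fin k) (Fin k) (PreLimit φ)) :
    ∀ᶠ n in atTop, A.map (term φ (n + 1)) = (A.map (term φ n)).map (φ n) := by
  have : ∀ᶠ n in atTop, ∀ i j, term φ (n + 1) (A i j) = φ n (term φ n (A i j)) :=
    eventually_all.2 fun i => eventually_all.2 fun j => eventually_coherent φ (A i j)
  filter_upwards [this] with n hn
  ext i j
  exact hn i j

/-- The constant sequence of units. -/
def unit : PreLimit φ := ofTerms φ (fun _ => ordUnit) (by simp [(φ _).map_unit])

theorem term_unit (n : ℕ) : term φ n (unit φ) = ordUnit := rfl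

theorem map_term_unit (n k : ℕ) :
    (Matrix.diagonal fun _ => unit φ : Matrix (Fin k) (Fin k) (PreLimit φ)).map (term φ n)
      = unitMat (S n) k := by
  ext i j
  by_cases h : i = j
  · subst h
    simp [unitMat, term_unit]
  · simp [unitMat, h]

/-- A hermitian matrix of sequences is in the cone if its terms are eventually in the cones. -/
instance : MatrixOrdered (PreLimit φ) where
  ordUnit := unit φ
  cone k := {A | Aᴴ = A ∧ ∀ᶠ n in atTop, A.map (term φ n) ∈ cone k}
  isHermitian_of_mem h := h.1
  add_mem {k A B} hA hB := by
    refine ⟨by rw [Matrix.conjTranspose_add, hA.1, hB.1], ?_⟩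
    filter_upwards [hA.2, hB.2] with n h1 h2
    convert MatrixOrdered.add_mem h1 h2 using 1
    ext i j
    simp
  smul_mem {k A r} hr hA := by
    refine ⟨by simp [Matrix.conjTranspose_smul, hA.1], ?_⟩
    filter_upwards [hA.2] with n h1
    convert MatrixOrdered.smul_mem hr h1 using 1
    ext i j
    simp
  compress_mem {k m A} α hA := by
    refine ⟨by rw [conjTranspose_compress, hA.1], ?_⟩
    filter_upwards [hA.2] with n h1
    rw [← compress_map]
    exact MatrixOrdered.compress_mem α h1
  exists_unit_add_mem {k A} hA := by
    obtain ⟨N, hN⟩ := eventually_atTop.1 (map_term_succ φ A)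
    obtain ⟨r, hr, h⟩ := MatrixOrdered.exists_unit_add_mem (V := S N) (A := A.map (term φ N)) (by
      ext i j
      simp only [Matrix.conjTranspose_apply, Matrix.map_apply]
      rw [← term_star, ← Matrix.conjTranspose_apply, hA])
    have hU : (Matrix.diagonal fun _ => unit φ : Matrix (Fin k) (Fin k) (PreLimit φ))ᴴ
        = Matrix.diagonal fun _ => unit φ := by
      rw [Matrix.diagonal_conjTranspose]
      congr 1
      funext i
      exact ext fun n => by
        simp only [Pi.star_apply, term_star, term_unit, star_ordUnit]
    have key : ∀ n, N ≤ n → (r : ℂ) • unitMat (S n) k + A.map (term φ n) ∈ cone k := by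
      intro n hn
      induction n, hn using Nat.le_induction with
      | base => exact h
      | succ n hn ih =>
        have h2 := (φ n).map_cone k _ ih
        convert h2 using 1
        rw [hN n hn]
        ext i j
        by_cases hij : i = j
        · subst hij
          simp [unitMat, (φ n).map_unit]
        · simp [unitMat, hij]
    refine ⟨r, hr, ?_, eventually_atTop.2 ⟨N, fun n hn => ?_⟩⟩
    · simp [Matrix.conjTranspose_add, Matrix.conjTranspose_smul, hA, hU]
    · convert key n hn using 1
      rw [← map_term_unit φ]
      ext i j
      simp only [Matrix.map_apply, Matrix.add_apply, Matrix.smul_apply, map_add, map_smul]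

theorem term_ordUnit (n : ℕ) : term φ n ordUnit = ordUnit := rfl

end PreLimit

/-- The inductive limit of the sequence `S₀ → S₁ → S₂ → ⋯` of operator systems. -/
abbrev InductiveLimit : Type _ := Archimedeanization (PreLimit φ)

namespace InductiveLimit

open PreLimit (term)

/-- The connecting map `Sₖ → Sₙ` for `k ≤ n`. -/
def connect {k n : ℕ} (h : k ≤ n) : UCP (S k) (S n) :=
  Nat.leRecOn h (fun {m} f => (φ m).comp f) (UCP.id (S k))

theorem connect_self (k : ℕ) (u : S k) : connect φ le_rfl u = u := by
  rw [connect, Nat.leRecOn_self]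
  rfl

theorem connect_succ {k n : ℕ} (h : k ≤ n) (u : S k) :
    connect φ (Nat.le_succ_of_le h) u = φ n (connect φ h u) := by
  rw [connect, Nat.leRecOn_succ h]
  rfl

theorem eventually_connect (k : ℕ) (u : S k) : ∀ᶠ n in atTop,
    (if h : k ≤ n + 1 then connect φ h u else 0)
      = φ n (if h : k ≤ n then connect φ h u else 0) :=
  (eventually_ge_atTop k).mono fun n hn => by
    rw [dif_pos hn, dif_pos (Nat.le_succ_of_le hn), connect_succ]

/-- The sequence `(0, …, 0, u, φₖ(u), φₖ₊₁(φₖ(u)), …)` with `u` in position `k`. -/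
def pushSeq (k : ℕ) (u : S k) : PreLimit φ :=
  PreLimit.ofTerms φ (fun n => if h : k ≤ n then connect φ h u else 0) (eventually_connect φ k u)

theorem term_pushSeq (k n : ℕ) (u : S k) :
    term φ n (pushSeq φ k u) = if h : k ≤ n then connect φ h u else 0 := rfl

/-- The sequence `(0, …, 0, u, φₖ(u), φₖ₊₁(φₖ(u)), …)`, as a linear function of `u`. -/
def push (k : ℕ) : S k →ₗ[ℂ] PreLimit φ where
  toFun := pushSeq φ k
  map_add' u v := PreLimit.ext fun n => by
    rw [map_add, term_pushSeq, term_pushSeq, term_pushSeq]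
    split_ifs <;> simp
  map_smul' c u := PreLimit.ext fun n => by
    rw [map_smul, term_pushSeq, term_pushSeq]
    split_ifs <;> simp

theorem term_push {k n : ℕ} (h : k ≤ n) (u : S k) : term φ n (push φ k u) = connect φ h u :=
  dif_pos h

theorem push_star (k : ℕ) (u : S k) : push φ k (star u) = star (push φ k u) :=
  PreLimit.ext fun n => by
    rw [PreLimit.term_star]
    change term φ n (pushSeq φ k (star u)) = star (term φ n (pushSeq φ k u))
    rw [term_pushSeq, term_pushSeq]
    split_ifs
    · exact UCP.map_star _ u
    · simp

/-- Sequences that agree eventually define the same element of the limit. -/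
theorem mk_eq_of_eventuallyEq {u v : PreLimit φ}
    (h : ∀ᶠ n in atTop, term φ n u = term φ n v) :
    Archimedeanization.mk (PreLimit φ) u = Archimedeanization.mk (PreLimit φ) v := by
  rw [← sub_eq_zero, ← map_sub, Archimedeanization.mk_eq_zero_iff]
  intro c r hr
  refine (pos_unit.smul hr.le).add ⟨?_, ?_⟩
  · ext i j
    change star (c • (u - v) + star (c • (u - v))) = c • (u - v) + star (c • (u - v))
    rw [star_add, star_star, add_comm]
  · filter_upwards [h] with n hn
    convert UCP.cone_zero_mem 1 using 1
    ext i j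
    change term φ n (c • (u - v) + star (c • (u - v))) = 0
    rw [map_add, PreLimit.term_star, map_smul, map_sub, hn]
    simp

/-- The canonical map `φ_{k,∞}` of `Sₖ` into the inductive limit. -/
def ι (k : ℕ) : UCP (S k) (InductiveLimit φ) where
  toLin := Archimedeanization.mk (PreLimit φ) ∘ₗ push φ k
  map_unit := by
    rw [← Archimedeanization.mk_ordUnit]
    refine mk_eq_of_eventuallyEq φ ?_
    filter_upwards [eventually_ge_atTop k] with n hn
    rw [term_push φ hn, UCP.map_unit, PreLimit.term_ordUnit]
  map_cone m A hA := by
    have h : A.map (push φ k) ∈ cone m := by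
      refine ⟨?_, ?_⟩
      · ext i j
        rw [Matrix.conjTranspose_apply, Matrix.map_apply, Matrix.map_apply, ← push_star,
          ← Matrix.conjTranspose_apply, MatrixOrdered.isHermitian_of_mem hA]
      · filter_upwards [eventually_ge_atTop k] with n hn
        convert (connect φ hn).map_cone m A hA using 1
        ext i j
        exact term_push φ hn _
    exact Archimedeanization.mem_cone_of_mem h

theorem ι_comp (k : ℕ) (u : S k) : ι φ (k + 1) (φ k u) = ι φ k u := by
  refine mk_eq_of_eventuallyEq φ ?_
  filter_upwards [eventually_ge_atTop (k + 1)] with n hn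
  rw [term_push φ hn, term_push φ (Nat.le_of_succ_le hn)]
  induction n, hn using Nat.le_induction with
  | base =>
    rw [connect_self]
    exact ((connect_succ φ le_rfl u).trans (by rw [connect_self])).symm
  | succ n hn ih => rw [connect_succ φ hn, ih, connect_succ φ (Nat.le_of_succ_le hn)]

theorem exists_rep (x : InductiveLimit φ) : ∃ (k : ℕ) (u : S k), x = ι φ k u := by
  obtain ⟨u, rfl⟩ := Archimedeanization.mk_surjective _ x
  obtain ⟨N, hN⟩ := eventually_atTop.1 (PreLimit.eventually_coherent φ u)
  refine ⟨N, term φ N u, mk_eq_of_eventuallyEq φ (eventually_atTop.2 ⟨N, fun n hn => ?_⟩)⟩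
  rw [term_push φ hn]
  induction n, hn using Nat.le_induction with
  | base => rw [connect_self]
  | succ n hn ih => rw [hN n hn, ih, connect_succ φ hn]

variable {φ} {R : Type*} [AddCommGroup R] [Module ℂ R] [StarAddMonoid R] [StarModule ℂ R]
  [OperatorSystem R]

theorem exists_eventual_value (ρ : ∀ n, UCP (S n) R) (hρ : ∀ n u, ρ (n + 1) (φ n u) = ρ n u)
    (u : PreLimit φ) : ∃ w : R, ∀ᶠ n in atTop, ρ n (term φ n u) = w := by
  obtain ⟨N, hN⟩ := eventually_atTop.1 (PreLimit.eventually_coherent φ u)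
  refine ⟨ρ N (term φ N u), eventually_atTop.2 ⟨N, fun n hn => ?_⟩⟩
  induction n, hn using Nat.le_induction with
  | base => rfl
  | succ n hn ih => rw [hN n hn, hρ, ih]

/-- The map `(uₙ)ₙ ↦ ρₙ(uₙ)`, `n` large. -/
def preDesc (ρ : ∀ n, UCP (S n) R) (hρ : ∀ n u, ρ (n + 1) (φ n u) = ρ n u) :
    UCP (PreLimit φ) R :=
  have key : ∀ u, ∀ᶠ n in atTop, ρ n (term φ n u) = (exists_eventual_value ρ hρ u).choose :=
    fun u => (exists_eventual_value ρ hρ u).choose_spec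
  { toLin :=
      { toFun := fun u => (exists_eventual_value ρ hρ u).choose
        map_add' := fun u v => by
          obtain ⟨n, h1, h2, h3⟩ := ((key u).and ((key v).and (key (u + v)))).exists
          rw [← h1, ← h2, ← h3, map_add, map_add]
        map_smul' := fun c u => by
          obtain ⟨n, h1, h2⟩ := ((key u).and (key (c • u))).exists
          rw [← h1, ← h2, map_smul, map_smul]
          rfl }
    map_unit := by
      obtain ⟨n, h⟩ := (key ordUnit).exists
      exact h.symm.trans (ρ n).map_unit
    map_cone := fun k A hA => by
      have : ∀ᶠ n in atTop, ∀ i j, ρ n (term φ n (A i j))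
          = (exists_eventual_value ρ hρ (A i j)).choose :=
        eventually_all.2 fun i => eventually_all.2 fun j => key (A i j)
      obtain ⟨n, h1, h2⟩ := (this.and hA.2).exists
      convert (ρ n).map_cone k _ h2 using 1
      ext i j
      exact (h1 i j).symm }

/-- The unital completely positive map on the inductive limit that is defined by a compatible
sequence of unital completely positive maps. -/
def desc (ρ : ∀ n, UCP (S n) R) (hρ : ∀ n u, ρ (n + 1) (φ n u) = ρ n u) :
    UCP (InductiveLimit φ) R :=
  Archimedeanization.lift (preDesc ρ hρ)

theorem desc_ι (ρ : ∀ n, UCP (S n) R) (hρ : ∀ n u, ρ (n + 1) (φ n u) = ρ n u) (k : ℕ)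
    (u : S k) : desc ρ hρ (ι φ k u) = ρ k u := by
  change (exists_eventual_value ρ hρ (push φ k u)).choose = _
  have h := (exists_eventual_value ρ hρ (push φ k u)).choose_spec
  obtain ⟨n, h1, hn⟩ := (h.and (eventually_ge_atTop k)).exists
  rw [← h1, term_push φ hn]
  clear h1 h
  induction n, hn using Nat.le_induction with
  | base => rw [connect_self]
  | succ n hn ih => rw [connect_succ φ hn, hρ, ih]

/-- The universal property of the inductive limit. -/
theorem existsUnique (ρ : ∀ n, UCP (S n) R) (hρ : ∀ n u, ρ (n + 1) (φ n u) = ρ n u) :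
    ∃! f : UCP (InductiveLimit φ) R, ∀ k u, f (ι φ k u) = ρ k u := by
  refine ⟨desc ρ hρ, desc_ι ρ hρ, fun g hg => UCP.ext fun x => ?_⟩
  obtain ⟨k, u, rfl⟩ := exists_rep φ x
  exact (hg k u).trans (desc_ι ρ hρ k u).symm

end InductiveLimit

end InductiveLimit

/-! ### The operator systems `B(K)`, its operator subsystems, and function spaces -/

section BoundedOperators

variable {K : Type*} [NormedAddCommGroup K] [InnerProductSpace ℂ K] [CompleteSpace K]

/-- The quadratic form `∑ ⟨ξᵢ, Aᵢⱼ ξⱼ⟩` of the operator `A` on `Kⁿ`. -/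
def opForm {n : ℕ} (A : Matrix (Fin n) (Fin n) (K →L[ℂ] K)) (ξ : Fin n → K) : ℂ :=
  ∑ i, ∑ j, inner ℂ (ξ i) (A i j (ξ j))

theorem opForm_add {n : ℕ} (A B : Matrix (Fin n) (Fin n) (K →L[ℂ] K)) (ξ : Fin n → K) :
    opForm (A + B) ξ = opForm A ξ + opForm B ξ := by
  simp [opForm, Finset.sum_add_distrib]

theorem opForm_smul {n : ℕ} (c : ℂ) (A : Matrix (Fin n) (Fin n) (K →L[ℂ] K)) (ξ : Fin n → K) :
    opForm (c • A) ξ = c * opForm A ξ := by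
  simp [opForm, Finset.mul_sum]

theorem opForm_diagonal_one {n : ℕ} (ξ : Fin n → K) :
    opForm (Matrix.diagonal fun _ => (1 : K →L[ℂ] K)) ξ = ((∑ i, ‖ξ i‖ ^ 2 : ℝ) : ℂ) := by
  rw [opForm]
  push_cast
  refine Finset.sum_congr rfl fun i _ => ?_
  rw [Finset.sum_eq_single i]
  · simp [inner_self_eq_norm_sq_to_K]
  · intro j _ hj
    simp [Matrix.diagonal_apply_ne _ hj.symm]
  · simp

theorem opForm_compress {n m : ℕ} (α : Matrix (Fin n) (Fin m) ℂ)
    (A : Matrix (Fin n) (Fin n) (K →L[ℂ] K)) (ξ : Fin m → K) :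
    opForm (compress α A) ξ = opForm A fun k => ∑ i, α k i • ξ i := by
  simp only [opForm, compress, _root_.sum_apply, _root_.smul_apply,
    inner_sum, sum_inner, map_sum, map_smul, inner_smul_left, inner_smul_right, Finset.mul_sum]
  calc ∑ i, ∑ j, ∑ k, ∑ l, star (α k i) * α l j * inner ℂ (ξ i) (A k l (ξ j))
      = ∑ i, ∑ k, ∑ l, ∑ j, star (α k i) * α l j * inner ℂ (ξ i) (A k l (ξ j)) := by
        refine Finset.sum_congr rfl fun i _ => ?_
        rw [Finset.sum_comm]
        exact Finset.sum_congr rfl fun k _ => Finset.sum_comm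
    _ = ∑ k, ∑ l, ∑ i, ∑ j, star (α k i) * α l j * inner ℂ (ξ i) (A k l (ξ j)) := by
        rw [Finset.sum_comm]
        exact Finset.sum_congr rfl fun k _ => Finset.sum_comm
    _ = _ := by
        refine Finset.sum_congr rfl fun k _ => Finset.sum_congr rfl fun l _ => ?_
        rw [Finset.sum_comm]
        refine Finset.sum_congr rfl fun j _ => Finset.sum_congr rfl fun i _ => ?_
        simp only [Complex.star_def]
        ring

theorem abs_re_opForm_le {n : ℕ} (A : Matrix (Fin n) (Fin n) (K →L[ℂ] K)) (ξ : Fin n → K) :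
    |(opForm A ξ).re| ≤ (∑ i, ∑ j, ‖A i j‖) * ∑ i, ‖ξ i‖ ^ 2 := by
  have hle : ∀ i, ‖ξ i‖ ^ 2 ≤ ∑ i, ‖ξ i‖ ^ 2 := fun i =>
    Finset.single_le_sum (f := fun i => ‖ξ i‖ ^ 2) (fun _ _ => by positivity) (Finset.mem_univ i)
  refine (Complex.abs_re_le_norm _).trans ((norm_sum_le _ _).trans ?_)
  rw [Finset.sum_mul]
  refine Finset.sum_le_sum fun i _ => (norm_sum_le _ _).trans ?_
  rw [Finset.sum_mul]
  refine Finset.sum_le_sum fun j _ => (norm_inner_le_norm _ _).trans ?_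
  calc ‖ξ i‖ * ‖A i j (ξ j)‖ ≤ ‖ξ i‖ * (‖A i j‖ * ‖ξ j‖) := by
        gcongr
        exact (A i j).le_opNorm _
    _ = ‖A i j‖ * (‖ξ i‖ * ‖ξ j‖) := by ring
    _ ≤ ‖A i j‖ * ∑ i, ‖ξ i‖ ^ 2 := by
        gcongr
        nlinarith [hle i, hle j, sq_nonneg (‖ξ i‖ - ‖ξ j‖)]

theorem add_mem_opCone {n : ℕ} (A : Matrix (Fin n) (Fin n) (K →L[ℂ] K)) (r : ℝ)
    (hr : ∑ i, ∑ j, ‖A i j‖ ≤ r) (ξ : Fin n → K) :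
    0 ≤ (opForm ((r : ℂ) • Matrix.diagonal (fun _ => (1 : K →L[ℂ] K)) + A) ξ).re := by
  rw [opForm_add, opForm_smul, opForm_diagonal_one, ← Complex.ofReal_mul, Complex.add_re,
    Complex.ofReal_re]
  have h1 := (abs_le.1 (abs_re_opForm_le A ξ)).1
  have h2 : (∑ i, ∑ j, ‖A i j‖) * ∑ i, ‖ξ i‖ ^ 2 ≤ r * ∑ i, ‖ξ i‖ ^ 2 :=
    mul_le_mul_of_nonneg_right hr (Finset.sum_nonneg fun _ _ => by positivity)
  linarith

theorem conjTranspose_diagonal_one {n : ℕ} (r : ℝ) :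
    ((r : ℂ) • Matrix.diagonal (fun _ : Fin n => (1 : K →L[ℂ] K)))ᴴ
      = (r : ℂ) • Matrix.diagonal (fun _ : Fin n => (1 : K →L[ℂ] K)) := by
  rw [Matrix.conjTranspose_smul, Matrix.diagonal_conjTranspose]
  congr 1
  · simp
  · congr 1
    funext i
    simp

/-- `M_n(B(K))⁺ = B(Kⁿ)⁺`. -/
instance : MatrixOrdered (K →L[ℂ] K) where
  ordUnit := 1
  cone n := {A | Aᴴ = A ∧ ∀ ξ : Fin n → K, 0 ≤ (opForm A ξ).re}
  isHermitian_of_mem h := h.1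
  add_mem {n A B} hA hB :=
    ⟨by rw [Matrix.conjTranspose_add, hA.1, hB.1], fun ξ => by
      rw [opForm_add, Complex.add_re]
      exact add_nonneg (hA.2 ξ) (hB.2 ξ)⟩
  smul_mem {n A r} hr hA :=
    ⟨by simp [Matrix.conjTranspose_smul, hA.1], fun ξ => by
      rw [opForm_smul, Complex.re_ofReal_mul]
      exact mul_nonneg hr (hA.2 ξ)⟩
  compress_mem {n m A} α hA :=
    ⟨by rw [conjTranspose_compress, hA.1], fun ξ => by
      rw [opForm_compress]
      exact hA.2 _⟩
  exists_unit_add_mem {n A} hA := by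
    have h0 : 0 ≤ ∑ i, ∑ j, ‖A i j‖ :=
      Finset.sum_nonneg fun _ _ => Finset.sum_nonneg fun _ _ => norm_nonneg _
    refine ⟨∑ i, ∑ j, ‖A i j‖ + 1, by linarith, ?_, add_mem_opCone A _ (by linarith)⟩
    rw [Matrix.conjTranspose_add, conjTranspose_diagonal_one, hA]

variable (K) in
/-- The cone `M_n(B(K))⁺`. -/
abbrev opCone (n : ℕ) : Set (Matrix (Fin n) (Fin n) (K →L[ℂ] K)) := cone n

theorem mem_opCone_iff {n : ℕ} {A : Matrix (Fin n) (Fin n) (K →L[ℂ] K)} :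
    A ∈ opCone K n ↔ Aᴴ = A ∧ ∀ ξ : Fin n → K, 0 ≤ (opForm A ξ).re := Iff.rfl

theorem opForm_im {n : ℕ} {A : Matrix (Fin n) (Fin n) (K →L[ℂ] K)} (hA : Aᴴ = A)
    (ξ : Fin n → K) : (opForm A ξ).im = 0 := by
  rw [← Complex.conj_eq_iff_im, opForm, map_sum]
  simp only [map_sum, inner_conj_symm]
  rw [Finset.sum_comm]
  refine Finset.sum_congr rfl fun i _ => Finset.sum_congr rfl fun j _ => ?_
  have : A i j = star (A j i) := by rw [← Matrix.conjTranspose_apply, hA]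
  rw [this, ContinuousLinearMap.star_eq_adjoint, ContinuousLinearMap.adjoint_inner_right]

theorem eq_zero_of_opForm {n : ℕ} {A : Matrix (Fin n) (Fin n) (K →L[ℂ] K)}
    (h : ∀ ξ, opForm A ξ = 0) : A = 0 := by
  let T : PiLp 2 (fun _ : Fin n => K) →ₗ[ℂ] PiLp 2 (fun _ : Fin n => K) :=
    { toFun := fun ξ => WithLp.toLp 2 fun i => ∑ j, A i j (ξ j)
      map_add' := fun ξ η => by
        ext i
        simp [Finset.sum_add_distrib]
      map_smul' := fun c ξ => by
        ext i
        simp [Finset.smul_sum] }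
  have hT : T = 0 := by
    rw [← inner_map_self_eq_zero]
    intro ξ
    rw [← inner_conj_symm, PiLp.inner_apply]
    have := h ξ
    simp only [opForm] at this
    simp only [T, LinearMap.coe_mk, AddHom.coe_mk, inner_sum, this, map_zero]
  ext i j x
  have h2 := congrArg (fun y : PiLp 2 (fun _ : Fin n => K) => y i)
    (LinearMap.congr_fun hT (WithLp.toLp 2 (Pi.single j x)))
  simp only [T, LinearMap.coe_mk, AddHom.coe_mk, LinearMap.zero_apply, PiLp.zero_apply] at h2
  rw [Finset.sum_eq_single j] at h2
  · simpa using h2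
  · intro k _ hk
    simp [Pi.single_eq_of_ne hk]
  · simp

instance : OperatorSystem (K →L[ℂ] K) where
  eq_zero_of_mem_neg_mem {n A} hA hA' := by
    refine eq_zero_of_opForm fun ξ => Complex.ext ?_ (opForm_im hA.1 ξ)
    have h := hA'.2 ξ
    have e : opForm (-A) ξ = -opForm A ξ := by
      simpa using opForm_smul (-1) A ξ
    rw [e, Complex.neg_re] at h
    rw [Complex.zero_re]
    exact le_antisymm (by linarith) (hA.2 ξ)
  archimedean {n A} hA := by
    refine ⟨isHermitian_of_add_unit (hA 1 one_pos), fun ξ => ?_⟩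
    refine le_of_forall_pos_le_add fun ε hε => ?_
    have hs : 0 ≤ ∑ i, ‖ξ i‖ ^ 2 := Finset.sum_nonneg fun _ _ => by positivity
    have h := (hA (ε / (∑ i, ‖ξ i‖ ^ 2 + 1)) (by positivity)).2 ξ
    have e : opForm (unitMat (K →L[ℂ] K) n) ξ = ((∑ i, ‖ξ i‖ ^ 2 : ℝ) : ℂ) :=
      opForm_diagonal_one ξ
    rw [opForm_add, opForm_smul, e, ← Complex.ofReal_mul, Complex.add_re, Complex.ofReal_re] at h
    have : ε / (∑ i, ‖ξ i‖ ^ 2 + 1) * ∑ i, ‖ξ i‖ ^ 2 ≤ ε := by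
      rw [div_mul_eq_mul_div, div_le_iff₀ (by positivity)]
      nlinarith
    linarith

end BoundedOperators

section Induced

variable {V W : Type*} [AddCommGroup V] [Module ℂ V] [StarAddMonoid V] [StarModule ℂ V]
  [AddCommGroup W] [Module ℂ W] [StarAddMonoid W] [StarModule ℂ W] [OperatorSystem W]

/-- The operator system structure that makes a given injective unital `*`-map into an operator
system a complete order embedding. -/
abbrev OperatorSystem.induced (j : V →ₗ[ℂ] W) (hj : Function.Injective j)
    (hs : ∀ v, j (star v) = star (j v)) (e : V) (he : j e = ordUnit) : OperatorSystem V :=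
  have hct : ∀ {n : ℕ} (A : Matrix (Fin n) (Fin n) V), (A.map j)ᴴ = Aᴴ.map j := fun A => by
    ext k l
    simp [hs]
  have hinj : ∀ {n : ℕ} {A B : Matrix (Fin n) (Fin n) V}, A.map j = B.map j → A = B :=
    fun h => Matrix.map_injective hj h
  have hadd : ∀ {n : ℕ} (A B : Matrix (Fin n) (Fin n) V), (A + B).map j = A.map j + B.map j :=
    fun A B => by
      ext k l
      simp
  have hsmul : ∀ {n : ℕ} (c : ℂ) (A : Matrix (Fin n) (Fin n) V), (c • A).map j = c • A.map j :=
    fun c A => by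
      ext k l
      simp
  have hunit : ∀ n : ℕ, (Matrix.diagonal fun _ => e : Matrix (Fin n) (Fin n) V).map j
      = unitMat W n := fun n => by
    ext k l
    by_cases h : k = l
    · subst h
      simp [unitMat, he]
    · simp [unitMat, h]
  { ordUnit := e
    cone := fun n => {A | A.map j ∈ cone n}
    isHermitian_of_mem := fun {n A} hA => hinj (by
      rw [← hct]
      exact MatrixOrdered.isHermitian_of_mem hA)
    add_mem := fun {n A B} hA hB => by
      rw [Set.mem_ofPred_eq, hadd]
      exact MatrixOrdered.add_mem hA hB
    smul_mem := fun {n A r} hr hA => by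
      rw [Set.mem_ofPred_eq, hsmul]
      exact MatrixOrdered.smul_mem hr hA
    compress_mem := fun {n m A} α hA => by
      rw [Set.mem_ofPred_eq, ← compress_map]
      exact MatrixOrdered.compress_mem α hA
    exists_unit_add_mem := fun {n A} hA => by
      obtain ⟨r, hr, h⟩ := MatrixOrdered.exists_unit_add_mem (A := A.map j) (by rw [hct, hA])
      refine ⟨r, hr, ?_⟩
      rw [Set.mem_ofPred_eq, hadd, hsmul, hunit]
      exact h
    eq_zero_of_mem_neg_mem := fun {n A} hA hA' => hinj (by
      have h2 : (-A).map j = -A.map j := by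
        ext k l
        simp
      rw [Matrix.map_zero _ (map_zero j)]
      refine OperatorSystem.eq_zero_of_mem_neg_mem hA ?_
      rw [← h2]
      exact hA')
    archimedean := fun {n A} hA => OperatorSystem.archimedean (A := A.map j) fun r hr => by
      have h := hA r hr
      rw [Set.mem_ofPred_eq, hadd, hsmul] at h
      rw [← hunit]
      exact h }

end Induced

/-- A unital `*`-subalgebra of `B(K)`, with `M_n(M)⁺ = M_n(M) ∩ B(Kⁿ)⁺`. -/
instance {K : Type*} [NormedAddCommGroup K] [InnerProductSpace ℂ K] [CompleteSpace K]
    (M : StarSubalgebra ℂ (K →L[ℂ] K)) : OperatorSystem M :=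
  OperatorSystem.induced M.subtype.toAlgHom.toLinearMap Subtype.val_injective (fun _ => rfl) 1 rfl

section Functions

/-- A complex matrix, regarded as a matrix of operators on the one-dimensional Hilbert space `ℂ`. -/
def scalarOp : ℂ →ₗ[ℂ] (ℂ →L[ℂ] ℂ) := LinearMap.toSpanSingleton ℂ _ 1

theorem scalarOp_apply (z w : ℂ) : scalarOp z w = z * w := by
  simp [scalarOp]

theorem scalarOp_one : scalarOp 1 = 1 := by
  simp [scalarOp]

theorem scalarOp_star (z : ℂ) : scalarOp (star z) = star (scalarOp z) := by
  simp [scalarOp, star_smul]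

theorem scalarOp_injective : Function.Injective scalarOp := fun z w h => by
  have := congrArg (fun T : ℂ →L[ℂ] ℂ => T 1) h
  simpa [scalarOp_apply] using this

theorem posSemidef_iff_scalarOp {n : ℕ} (M : Matrix (Fin n) (Fin n) ℂ) :
    M.PosSemidef ↔ M.map scalarOp ∈ opCone ℂ n := by
  have hH : (M.map scalarOp)ᴴ = M.map scalarOp ↔ M.IsHermitian := by
    have : (M.map scalarOp)ᴴ = Mᴴ.map scalarOp := by
      ext1 i j
      exact (scalarOp_star _).symm
    rw [this]
    exact ⟨fun h => Matrix.map_injective scalarOp_injective h, fun h => by rw [h.eq]⟩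
  have hF : ∀ x : Fin n → ℂ, opForm (M.map scalarOp) x = star x ⬝ᵥ (M *ᵥ x) := fun x => by
    simp only [opForm, dotProduct, Matrix.mulVec, Finset.mul_sum, Matrix.map_apply,
      scalarOp_apply, Pi.star_apply]
    refine Finset.sum_congr rfl fun i _ => Finset.sum_congr rfl fun j _ => ?_
    simp [mul_comm]
  rw [Matrix.posSemidef_iff_dotProduct_mulVec, mem_opCone_iff, hH]
  refine and_congr_right fun h => forall_congr' fun x => ?_
  rw [← hF, Complex.le_def]
  simp [opForm_im (hH.2 h)]

variable {V Ω : Type*} [AddCommGroup V] [Module ℂ V] [StarAddMonoid V] [StarModule ℂ V]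

/-- The operator system structure on a space `V` of bounded functions on `Ω` (with evaluations
`ev`), in which a matrix is positive if all its values are positive semi-definite. -/
abbrev OperatorSystem.ofFunctions (ev : Ω → V →ₗ[ℂ] ℂ)
    (hext : ∀ v, (∀ ω, ev ω v = 0) → v = 0) (hs : ∀ ω v, ev ω (star v) = star (ev ω v))
    (hb : ∀ v, ∃ C : ℝ, ∀ ω, ‖ev ω v‖ ≤ C) (e : V) (he : ∀ ω, ev ω e = 1) : OperatorSystem V :=
  have hext' : ∀ {v w : V}, (∀ ω, ev ω v = ev ω w) → v = w := fun {v w} h =>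
    sub_eq_zero.1 (hext _ fun ω => by rw [map_sub, h, sub_self])
  have hadd : ∀ (ω : Ω) {n : ℕ} (A B : Matrix (Fin n) (Fin n) V),
      (A + B).map (ev ω) = A.map (ev ω) + B.map (ev ω) := fun ω n A B => by
    ext k l
    simp
  have hsmul : ∀ (ω : Ω) {n : ℕ} (c : ℂ) (A : Matrix (Fin n) (Fin n) V),
      (c • A).map (ev ω) = c • A.map (ev ω) := fun ω n c A => by
    ext k l
    simp
  have hunit : ∀ (ω : Ω) (n : ℕ), (Matrix.diagonal fun _ => e : Matrix (Fin n) (Fin n) V).map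
      (ev ω) = 1 := fun ω n => by
    ext k l
    by_cases h : k = l
    · subst h
      simp [he]
    · simp [h]
  { ordUnit := e
    cone := fun n => {A | ∀ ω, (A.map (ev ω)).PosSemidef}
    isHermitian_of_mem := fun {n A} hA => by
      ext k l
      refine hext' fun ω => ?_
      rw [Matrix.conjTranspose_apply, hs]
      exact congrFun (congrFun (hA ω).1 k) l
    add_mem := fun {n A B} hA hB ω => by
      rw [hadd]
      exact (hA ω).add (hB ω)
    smul_mem := fun {n A r} hr hA ω => by
      rw [hsmul]
      exact (hA ω).smul (by exact_mod_cast hr)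
    compress_mem := fun {n m A} α hA ω => by
      rw [← compress_map, posSemidef_iff_scalarOp, ← compress_map]
      exact MatrixOrdered.compress_mem α ((posSemidef_iff_scalarOp _).1 (hA ω))
    exists_unit_add_mem := fun {n A} hA => by
      choose C hC using fun k l => hb (A k l)
      refine ⟨∑ k, ∑ l, |C k l| + 1, ?_, fun ω => ?_⟩
      · have : 0 ≤ ∑ k, ∑ l, |C k l| :=
          Finset.sum_nonneg fun _ _ => Finset.sum_nonneg fun _ _ => abs_nonneg _
        linarith
      · rw [hadd, hsmul, hunit, posSemidef_iff_scalarOp]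
        set r : ℝ := ∑ k, ∑ l, |C k l| + 1
        have e1 : ((r : ℂ) • (1 : Matrix (Fin n) (Fin n) ℂ) + A.map (ev ω)).map scalarOp
            = (r : ℂ) • Matrix.diagonal (fun _ => (1 : ℂ →L[ℂ] ℂ)) + (A.map (ev ω)).map scalarOp := by
          ext1 k l
          by_cases h : k = l
          · subst h
            simp only [Matrix.map_apply, Matrix.add_apply, Matrix.smul_apply,
              Matrix.one_apply_eq, Matrix.diagonal_apply_eq, map_add, map_smul, scalarOp_one]
          · simp only [Matrix.map_apply, Matrix.add_apply, Matrix.smul_apply,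
              Matrix.one_apply_ne h, Matrix.diagonal_apply_ne _ h, map_add, map_smul, map_zero]
        have hH : ((A.map (ev ω)).map scalarOp)ᴴ = (A.map (ev ω)).map scalarOp := by
          ext1 k l
          simp only [Matrix.conjTranspose_apply, Matrix.map_apply]
          rw [← scalarOp_star, ← hs, ← Matrix.conjTranspose_apply, hA]
        rw [e1]
        refine ⟨?_, add_mem_opCone _ _ ?_⟩
        · rw [Matrix.conjTranspose_add, conjTranspose_diagonal_one, hH]
        · have : ∀ k l, ‖(A.map (ev ω)).map scalarOp k l‖ ≤ |C k l| := fun k l => by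
            refine (ContinuousLinearMap.opNorm_le_bound _ (norm_nonneg (ev ω (A k l)))
              fun z => ?_).trans ((hC k l ω).trans (le_abs_self _))
            simp [scalarOp_apply]
          have := Finset.sum_le_sum fun k (_ : k ∈ Finset.univ) =>
            Finset.sum_le_sum fun l (_ : l ∈ Finset.univ) => this k l
          linarith
    eq_zero_of_mem_neg_mem := fun {n A} hA hA' => by
      ext k l
      refine hext' fun ω => ?_
      have h1 := (posSemidef_iff_scalarOp _).1 (hA ω)
      have h2 := (posSemidef_iff_scalarOp _).1 (hA' ω)
      have e1 : ((-A).map (ev ω)).map scalarOp = -(A.map (ev ω)).map scalarOp := by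
        ext1 k l
        simp
      rw [e1] at h2
      have h3 := congrFun (congrFun (OperatorSystem.eq_zero_of_mem_neg_mem h1 h2) k) l
      refine scalarOp_injective ?_
      rw [Matrix.zero_apply, map_zero, map_zero]
      exact h3
    archimedean := fun {n A} hA ω => by
      rw [posSemidef_iff_scalarOp]
      refine OperatorSystem.archimedean fun r hr => ?_
      have h := hA r hr ω
      rw [hadd, hsmul, posSemidef_iff_scalarOp] at h
      convert h using 1
      ext1 k l
      by_cases h : k = l
      · subst h
        simp only [unitMat, Matrix.add_apply, Matrix.smul_apply, Matrix.map_apply,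
          Matrix.diagonal_apply_eq, map_add, map_smul, he, scalarOp_one]
        rfl
      · simp [unitMat, h] }

/-- The diagonal algebra `D_A` of a finite set `A`. -/
abbrev DiagAlg (A : Type*) := A → ℂ

instance {A : Type*} [Fintype A] : OperatorSystem (DiagAlg A) :=
  OperatorSystem.ofFunctions (fun a => (LinearMap.proj a : (A → ℂ) →ₗ[ℂ] ℂ))
    (fun _ h => funext h) (fun _ _ => rfl)
    (fun v => ⟨∑ a, ‖v a‖, fun a =>
      Finset.single_le_sum (f := fun a => ‖v a‖) (fun _ _ => norm_nonneg _) (Finset.mem_univ a)⟩)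
    1 (fun _ => rfl)

/-- The C*-algebra `C(Ω)` of a compact space; a matrix over `C(Ω)` is positive if it is so at each
point. -/
instance {Ω : Type*} [TopologicalSpace Ω] [CompactSpace Ω] : OperatorSystem C(Ω, ℂ) :=
  OperatorSystem.ofFunctions
    (fun ω => { toFun := fun f => f ω, map_add' := fun _ _ => rfl, map_smul' := fun _ _ => rfl })
    (fun _ h => ContinuousMap.ext h) (fun _ _ => rfl) (fun f => ⟨‖f‖, fun ω => f.norm_coe_le_norm ω⟩)
    1 (fun _ => rfl)

end Functions

/-! ### Inductive families of finite sets and their Cantor spaces -/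

/-- An inductive family of finite sets `X₁, X₂, …` (indexed here from `0`), with
`Xₙ₊₁ = Xₙ × [d]` and with the first set identified with `[d 0]`. -/
structure InductiveFamily where
  /-- the finite sets -/
  stage : ℕ → Type
  [fintype : ∀ n, Fintype (stage n)]
  /-- the number of points of the first set, and of the successive factors -/
  d : ℕ → ℕ
  [neZero : ∀ n, NeZero (d n)]
  baseEquiv : stage 0 ≃ Fin (d 0)
  succEquiv : ∀ n, stage (n + 1) ≃ stage n × Fin (d (n + 1))

namespace InductiveFamily

attribute [instance] InductiveFamily.fintype InductiveFamily.neZero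

variable (X : InductiveFamily)

instance (n : ℕ) : Nonempty (X.stage n) := by
  induction n with
  | zero => exact X.baseEquiv.nonempty
  | succ n ih => exact (X.succEquiv n).nonempty

/-- The Cantor space `Ω_X = ∏ [dₙ]`, with the product topology and the product `σ`-algebra. -/
abbrev Omega : Type := ∀ n, Fin (X.d n)

/-- The projection of `Ω_X` onto the first coordinates. -/
def proj : ∀ n, X.Omega → X.stage n
  | 0 => fun ω => X.baseEquiv.symm (ω 0)
  | n + 1 => fun ω => (X.succEquiv n).symm (proj n ω, ω (n + 1))

theorem isLocallyConstant_coord (n : ℕ) : IsLocallyConstant fun ω : X.Omega => ω n :=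
  (IsLocallyConstant.iff_continuous _).2 (continuous_apply n)

theorem isLocallyConstant_proj (n : ℕ) : IsLocallyConstant (X.proj n) := by
  induction n with
  | zero => exact (X.isLocallyConstant_coord 0).comp X.baseEquiv.symm
  | succ n ih =>
    exact (ih.prodMk (X.isLocallyConstant_coord (n + 1))).comp (X.succEquiv n).symm

/-- The cylinder `x̃ ⊆ Ω_X` of all points whose first coordinates are given by `x`. -/
def cyl (n : ℕ) (x : X.stage n) : Set X.Omega := {ω | X.proj n ω = x}

theorem measurableSet_cyl (n : ℕ) (x : X.stage n) : MeasurableSet (X.cyl n x) :=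
  ((X.isLocallyConstant_proj n).isOpen_fiber x).measurableSet

/-- The product `μ_X` of the uniform probability measures. -/
def mu : Measure X.Omega :=
  Measure.infinitePi fun n => (PMF.uniformOfFintype (Fin (X.d n))).toMeasure

instance : IsProbabilityMeasure X.mu := by
  unfold mu
  infer_instance

/-- The embedding `D_{Xₙ} → D_{Xₙ₊₁}`, `T ↦ T ⊗ I`. -/
def diagIncl (n : ℕ) : UCP (DiagAlg (X.stage n)) (DiagAlg (X.stage (n + 1))) where
  toLin := LinearMap.funLeft ℂ ℂ fun y => (X.succEquiv n y).1
  map_unit := rfl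
  map_cone _ _ hA y := hA (X.succEquiv n y).1

/-- The canonical map `D_{Xₙ} → D_X = C(Ω_X)`. -/
def cantorIncl (n : ℕ) : UCP (DiagAlg (X.stage n)) C(X.Omega, ℂ) where
  toLin :=
    { toFun := fun u => ⟨fun ω => u (X.proj n ω), ((X.isLocallyConstant_proj n).comp u).continuous⟩
      map_add' := fun _ _ => rfl
      map_smul' := fun _ _ => rfl }
  map_unit := rfl
  map_cone _ _ hA ω := hA (X.proj n ω)

end InductiveFamily

/-! ### The Cantor operator system -/

/-- The operator system `S_{X,A}` of finite sets `X` and `A`: the coproduct of `|X|` copies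
of `D_A`. -/
abbrev FinSystem (X A : Type) [Fintype X] [Fintype A] : Type := Coproduct fun _ : X => DiagAlg A

section Cantor

variable (X A : InductiveFamily)

/-- The map `⊕̇ ι` from `S_{Xₙ,Aₙ}` to `S_{Xₙ,Aₙ₊₁}`. -/
def refineOutputs (n : ℕ) :
    UCP (FinSystem (X.stage n) (A.stage n)) (FinSystem (X.stage n) (A.stage (n + 1))) :=
  Coproduct.map fun _ => A.diagIncl n

/-- The map `⊕̇ β` from `S_{Xₙ,Aₙ₊₁}` to `S_{Xₙ₊₁,Aₙ₊₁}`; its restriction to the copy of `D_{Aₙ₊₁}`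
with label `x` is the average of the inclusions as the copies with labels `(x,1), …, (x,d)`. -/
def averageInputs (n : ℕ) :
    UCP (FinSystem (X.stage n) (A.stage (n + 1)))
      (FinSystem (X.stage (n + 1)) (A.stage (n + 1))) :=
  Coproduct.desc fun x => UCP.average fun k : Fin (X.d (n + 1)) =>
    Coproduct.ι (fun _ => DiagAlg (A.stage (n + 1))) ((X.succEquiv n).symm (x, k))

/-- The connecting map `γ` from `S_{Xₙ,Aₙ}` to `S_{Xₙ₊₁,Aₙ₊₁}`. -/
def gamma (n : ℕ) :
    UCP (FinSystem (X.stage n) (A.stage n)) (FinSystem (X.stage (n + 1)) (A.stage (n + 1))) :=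
  (averageInputs X A n).comp (refineOutputs X A n)

/-- The Cantor operator system `S_{X,A} = lim S_{Xₙ,Aₙ}`. -/
abbrev CantorSystem : Type :=
  InductiveLimit (S := fun n => FinSystem (X.stage n) (A.stage n)) (gamma X A)

/-- The canonical map `γ⁽ⁿ⁾` from `S_{Xₙ,Aₙ}` to `S_{X,A}`. -/
def gammaIncl (n : ℕ) : UCP (FinSystem (X.stage n) (A.stage n)) (CantorSystem X A) :=
  InductiveLimit.ι (S := fun n => FinSystem (X.stage n) (A.stage n)) (gamma X A) n

end Cantor

/-! ### The von Neumann algebra `L^∞(Ω_X) ⊗̄ B(H)` -/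

/-- The von Neumann algebra generated by a set of operators: the double commutant of the set and
its adjoints. -/
def generatedVNA {K : Type*} [NormedAddCommGroup K] [InnerProductSpace ℂ K] [CompleteSpace K]
    (G : Set (K →L[ℂ] K)) : VonNeumannAlgebra K where
  toStarSubalgebra := StarSubalgebra.centralizer ℂ
    (StarSubalgebra.centralizer ℂ G : Set (K →L[ℂ] K))
  centralizer_centralizer' := by
    change Set.centralizer (Set.centralizer
      (Set.centralizer ((StarSubalgebra.centralizer ℂ G : Set (K →L[ℂ] K))
        ∪ star (StarSubalgebra.centralizer ℂ G : Set (K →L[ℂ] K)))))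
      = Set.centralizer _
    rw [Set.centralizer_centralizer_centralizer]

section Tensor

variable {Ω : Type*} [MeasurableSpace Ω] (μ : Measure Ω)
  (H : Type*) [NormedAddCommGroup H] [InnerProductSpace ℂ H] [CompleteSpace H]

/-- The operators `M_f ⊗ T` on `L²(Ω) ⊗ H = L²(Ω; H)`, for `f ∈ L^∞(Ω)` and `T ∈ B(H)`. -/
def elementaryTensors : Set (Lp H 2 μ →L[ℂ] Lp H 2 μ) :=
  {W | ∃ (f : Ω → ℂ) (T : H →L[ℂ] H), MemLp f ⊤ μ ∧
    ∀ F : Lp H 2 μ, W F =ᵐ[μ] fun ω => f ω • T (F ω)}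

/-- The von Neumann algebra tensor product `L^∞(Ω, μ) ⊗̄ B(H)`, acting on `L²(Ω; H)`. -/
def LinftyTensor : VonNeumannAlgebra (Lp H 2 μ) := generatedVNA (elementaryTensors μ H)

end Tensor

section Channels

variable (X : InductiveFamily) (H : Type*) [NormedAddCommGroup H] [InnerProductSpace ℂ H]
  [CompleteSpace H]

/-- The operator system `L^∞(Ω_X) ⊗̄ B(H)`. -/
abbrev ChannelAlg : Type _ := (LinftyTensor X.mu H).toStarSubalgebra

variable {H}

/-- The map `ξ ↦ χ_x̃ ⊗ ξ` from `H` to `L²(Ω_X; H)`. -/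
def cylEmbed (n : ℕ) (x : X.stage n) : H →L[ℂ] Lp H 2 X.mu :=
  LinearMap.mkContinuous
    { toFun := fun ξ => indicatorConstLp 2 (X.measurableSet_cyl n x) (measure_ne_top X.mu _) ξ
      map_add' := fun _ _ => (indicatorConstLp_add).symm
      map_smul' := fun c ξ => by
        ext1
        refine indicatorConstLp_coeFn.trans ?_
        filter_upwards [Lp.coeFn_smul c (indicatorConstLp 2 (X.measurableSet_cyl n x)
          (measure_ne_top X.mu _) ξ), indicatorConstLp_coeFn (p := 2) (c := ξ)
          (hs := X.measurableSet_cyl n x) (hμs := measure_ne_top X.mu _)] with ω h1 h2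
        rw [RingHom.id_apply, h1, Pi.smul_apply, h2]
        by_cases h : ω ∈ X.cyl n x <;> simp [h] }
    (X.mu.real (X.cyl n x) ^ (1 / (2 : ENNReal).toReal)) fun ξ => by
      rw [mul_comm]
      exact norm_indicatorConstLp_le (hs := X.measurableSet_cyl n x)
        (hμs := measure_ne_top X.mu _)

/-- The conditional expectation `Ẽ : L^∞(Ω_X) ⊗̄ B(H) → D_{Xₙ} ⊗ B(H)`, where `D_{Xₙ} ⊗ B(H)` is
the space of functions from `Xₙ` to `B(H)`.  The value of `Ẽ(S)` at `x` is determined by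
`⟨Ẽ(S)(x) ξ, η⟩ = |Xₙ| ⟨S (χ_x̃ ⊗ ξ), χ_x̃ ⊗ η⟩`; thus `Ẽ(f ⊗ T)(x) = (|Xₙ| ∫_x̃ f dμ_X) T`. -/
def condExpect (n : ℕ) (S : ChannelAlg X H) (x : X.stage n) : H →L[ℂ] H :=
  (Fintype.card (X.stage n) : ℂ) • ((cylEmbed X n x).adjoint ∘L (S : Lp H 2 X.mu →L[ℂ] Lp H 2 X.mu)
    ∘L cylEmbed X n x)

/-- A unital completely positive map `Γ` on `S_{X,A}` and a unital completely positive map `Φ` from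
`C(Ω_A)` into `L^∞(Ω_X) ⊗̄ B(H)` correspond to each other if, for all `n`, the compression
`Φₙ` of `Φ` to a map from `D_{Aₙ}` to `D_{Xₙ} ⊗ B(H)` and the restriction `Γₙ` of `Γ` to
`S_{Xₙ,Aₙ}` satisfy `Φₙ(u) = ∑ₓ δₓ ⊗ Γₙ(ιₓ(u))`. -/
def Corresponds {A : InductiveFamily} (Γ : UCP (CantorSystem X A) (H →L[ℂ] H))
    (Φ : UCP C(A.Omega, ℂ) (ChannelAlg X H)) : Prop :=
  ∀ (n : ℕ) (u : DiagAlg (A.stage n)) (x : X.stage n),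
    condExpect X n (Φ (A.cantorIncl n u)) x
      = Γ (gammaIncl X A n (Coproduct.ι (fun _ => DiagAlg (A.stage n)) x u))

end Channels

end CantorOpSys

end

noncomputable section

set_option linter.unusedSectionVars false

/-! A unital completely positive (UCP) map on the Cantor system amounts to a martingale. By the
universal properties of coproduct and limit, `Γ` is a family of UCP maps `u ↦ Γ(γ⁽ⁿ⁾(ι_x(u)))` on
the algebras `D_{Aₙ}`, indexed by cylinders, and compatibility with the connecting maps says that
the value at `x` is the average of the values at the children `(x, k)`. The conditional expectations
of an element of `L^∞(Ω_X) ⊗̄ B(H)` satisfy the same relation, and the theorem identifies the two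
kinds of data.

From `Φ` to `Γ`: elements of the algebra commute with the projections `χ_x̃ ⊗ 1`, hence have no
off-diagonal blocks between distinct cylinders of one level (`adjoint_cylEmbed_channel`). The
expectation at `x` is therefore the average of those at its children (`condExpect_eq_average`),
which is the compatibility required by the inductive limit.

From `Γ` to `Φ`: the step operators `∑ₓ χ_x̃ ⊗ Γ(γ⁽ⁿ⁾(ι_x(u)))`, with `u` the samples of a
continuous function on the level-`n` cylinders of `Ω_A`, define UCP maps. UCP maps are bounded
pointwise, uniformly over all such maps (`UCP.norm_le`), so a nonprincipal ultrafilter gives a weak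
limit (`UCP.exists_weak_limit`), which is again UCP and has values in the double commutant
(`mem_of_weak_limit`). At a fixed level, and for a fixed function of finitely many coordinates, the
expectations of the step operators are eventually constant by the martingale relation, and the limit
inherits their value.

Uniqueness makes the two constructions inverse to each other. `Γ` is determined because every
element of the limit comes from a finite stage, which is spanned by the images of the `ι_x`. `Φ` is
determined because expectations separate the algebra (`channel_ext`) and functions of finitely many
coordinates are norm dense in `C(Ω_A)`. -/

namespace CantorOpSys

open Filter MeasureTheory
open scoped Matrix ComplexOrder
open MatrixOrdered (ordUnit cone)
open scoped Topology

/-! ### Norm bounds and weak limits for UCP maps into `B(K)` -/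

section BoundedOperators

variable {K : Type*} [NormedAddCommGroup K] [InnerProductSpace ℂ K] [CompleteSpace K]

/-- The matrix with rows `(r e, v)` and `(v*, r e)`. -/
def dilation {V : Type*} [AddCommGroup V] [Module ℂ V] [Star V] (e : V) (r : ℝ) (v : V) :
    Matrix (Fin 2) (Fin 2) V :=
  !![(r : ℂ) • e, v; star v, (r : ℂ) • e]

theorem norm_le_of_dilation_mem {T : K →L[ℂ] K} {r : ℝ} (hr : 0 < r)
    (h : dilation (1 : K →L[ℂ] K) r T ∈ cone 2) : ‖T‖ ≤ r := by
  refine T.opNorm_le_bound hr.le fun η => ?_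
  -- Minimizing the form over the first vector, with the second fixed at `η`, suggests `-r⁻¹ T η`;
  -- the form there equals `r ‖η‖² - r⁻¹ ‖T η‖²`.
  have h1 := h.2 ![-((r⁻¹ : ℝ) : ℂ) • T η, η]
  simp only [dilation, opForm, Fin.sum_univ_two, Matrix.cons_val_zero, Matrix.cons_val_one,
    Matrix.of_apply, Matrix.cons_val', Matrix.cons_val_fin_one, ContinuousLinearMap.star_eq_adjoint,
    ContinuousLinearMap.adjoint_inner_right, inner_smul_left, inner_smul_right,
    map_smul, smul_apply, one_apply_eq_self, inner_self_eq_norm_sq_to_K] at h1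
  have h2 : 0 ≤ r * (r⁻¹ * (r⁻¹ * ‖T η‖ ^ 2)) - r⁻¹ * ‖T η‖ ^ 2
      + (-r⁻¹ * ‖T η‖ ^ 2 + r * ‖η‖ ^ 2) := by
    convert h1 using 1
    rw [← Complex.ofReal_re (r * (r⁻¹ * (r⁻¹ * ‖T η‖ ^ 2)) - r⁻¹ * ‖T η‖ ^ 2
      + (-r⁻¹ * ‖T η‖ ^ 2 + r * ‖η‖ ^ 2))]
    congr 1
    push_cast
    simp
    ring
  have h3 : 0 ≤ r⁻¹ * ((r * ‖η‖) ^ 2 - ‖T η‖ ^ 2) := by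
    convert h2 using 1
    field_simp
    ring
  have h4 : 0 ≤ (r * ‖η‖) ^ 2 - ‖T η‖ ^ 2 := nonneg_of_mul_nonneg_right h3 (by positivity)
  exact abs_le_of_sq_le_sq' (by linarith) (by positivity) |>.2

section UCPBound

variable {V : Type*} [AddCommGroup V] [Module ℂ V] [StarAddMonoid V] [StarModule ℂ V]
  [MatrixOrdered V]

/-- Unitality and `*`-preservation carry the dilation of `v` to that of `f v`. Thus an
order-theoretic condition on `v` alone bounds `f v` for all `f` at once, although `V` carries no
norm. -/
theorem UCP.norm_le (f : UCP V (K →L[ℂ] K)) {v : V} {r : ℝ} (hr : 0 < r)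
    (h : dilation ordUnit r v ∈ cone 2) : ‖f v‖ ≤ r := by
  refine norm_le_of_dilation_mem hr ?_
  convert f.map_cone 2 _ h using 1
  ext1 i j
  fin_cases i <;> fin_cases j <;> simp [dilation, f.map_star] <;> rw [f.map_unit] <;> rfl

/-- Every element has a positive dilation, which bounds its images under unital completely positive
maps into `B(K)`. -/
theorem exists_dilation_mem (v : V) : ∃ r : ℝ, 0 < r ∧ dilation ordUnit r v ∈ cone 2 := by
  obtain ⟨r, hr, h⟩ := MatrixOrdered.exists_unit_add_mem (V := V) (n := 2)
    (A := !![0, v; star v, 0]) (by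
      ext i j
      fin_cases i <;> fin_cases j <;> simp)
  refine ⟨r, hr, ?_⟩
  convert h using 1
  ext i j
  fin_cases i <;> fin_cases j <;> simp [dilation]

end UCPBound

section WeakLimit

variable {ι : Type*} (U : Ultrafilter ι)

theorem exists_tendsto_of_bounded {z : ι → ℂ} {C : ℝ} (hz : ∀ i, ‖z i‖ ≤ C) :
    ∃ w : ℂ, Tendsto z U (𝓝 w) := by
  obtain ⟨w, -, hw⟩ := (isCompact_closedBall (0 : ℂ) C).ultrafilter_le_nhds (U.map z) (by
    rw [Ultrafilter.coe_map, le_principal_iff]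
    exact Filter.mem_map.2 (Filter.univ_mem' fun i => by simpa using hz i))
  exact ⟨w, hw⟩

/-- A bounded family of operators converges weakly along every ultrafilter. -/
theorem exists_weak_limit {S : ι → K →L[ℂ] K} {C : ℝ} (hS : ∀ i, ‖S i‖ ≤ C) :
    ∃ T : K →L[ℂ] K, ∀ ξ η, Tendsto (fun i => inner ℂ ξ (S i η)) U (𝓝 (inner ℂ ξ (T η))) := by
  have hb : ∀ (ξ η : K) i, ‖inner ℂ (S i ξ) η‖ ≤ C * ‖ξ‖ * ‖η‖ := fun ξ η i =>
    (norm_inner_le_norm _ _).trans (by gcongr; exact (S i).le_of_opNorm_le (hS i) ξ)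
  -- The limit is built as a sesquilinear form bounded by `C` and then represented by an operator.
  -- The operator stands in the first slot of the inner product, so that the form is
  -- conjugate-linear in its first argument, as the representation theorem requires; conjugation
  -- restores the order at the end.
  choose B hB using fun ξ η => exists_tendsto_of_bounded U (hb ξ η)
  have hu : ∀ {z : ι → ℂ} {a b : ℂ}, Tendsto z U (𝓝 a) → Tendsto z U (𝓝 b) → a = b :=
    fun h h' => tendsto_nhds_unique h h'
  let B' : K →L⋆[ℂ] K →L[ℂ] ℂ := LinearMap.mkContinuous₂
    (LinearMap.mk₂'ₛₗ (starRingEnd ℂ) (RingHom.id ℂ) B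
      (fun ξ ξ' η => hu (hB _ _) (by simpa [inner_add_left] using (hB ξ η).add (hB ξ' η)))
      (fun c ξ η => hu (hB _ _) (by
        simpa [inner_smul_left, mul_comm] using (hB ξ η).const_mul ((starRingEnd ℂ) c)))
      (fun ξ η η' => hu (hB _ _) (by simpa [inner_add_right] using (hB ξ η).add (hB ξ η')))
      (fun c ξ η => hu (hB _ _) (by simpa [inner_smul_right] using (hB ξ η).const_mul c)))
    C fun ξ η => le_of_tendsto (hB ξ η).norm (Eventually.of_forall (hb ξ η))
  refine ⟨InnerProductSpace.continuousLinearMapOfBilin B', fun ξ η => ?_⟩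
  have h : inner ℂ (InnerProductSpace.continuousLinearMapOfBilin B' η) ξ = B η ξ :=
    InnerProductSpace.continuousLinearMapOfBilin_apply B' η ξ
  rw [← inner_conj_symm, h]
  simp_rw [← inner_conj_symm ξ]
  exact (Complex.continuous_conj.tendsto _).comp (hB η ξ)

theorem ext_inner_operator {S T : K →L[ℂ] K} (h : ∀ ξ η, inner ℂ ξ (S η) = inner ℂ ξ (T η)) :
    S = T :=
  ContinuousLinearMap.ext fun η => ext_inner_left ℂ fun ξ => h ξ η

variable {V : Type*} [AddCommGroup V] [Module ℂ V] [StarAddMonoid V] [StarModule ℂ V]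
  [MatrixOrdered V]

/-- A family of unital completely positive maps into `B(K)` converges pointwise weakly along every
ultrafilter. -/
theorem UCP.exists_weak_limit (f : ι → UCP V (K →L[ℂ] K)) :
    ∃ g : UCP V (K →L[ℂ] K), ∀ v ξ η,
      Tendsto (fun i => inner ℂ ξ (f i v η)) U (𝓝 (inner ℂ ξ (g v η))) := by
  have : ∀ v : V, ∃ T : K →L[ℂ] K, ∀ ξ η,
      Tendsto (fun i => inner ℂ ξ (f i v η)) U (𝓝 (inner ℂ ξ (T η))) := fun v => by
    -- The bound `r` depends on `v` but not on the index.
    obtain ⟨r, hr, h⟩ := exists_dilation_mem v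
    exact CantorOpSys.exists_weak_limit U fun i => (f i).norm_le hr h
  choose g hg using this
  have hu : ∀ {z : ι → ℂ} {a b : ℂ}, Tendsto z U (𝓝 a) → Tendsto z U (𝓝 b) → a = b :=
    fun h h' => tendsto_nhds_unique h h'
  -- Linearity, unitality, hermiticity and positivity of the quadratic forms are conditions on
  -- finitely many matrix coefficients, and each is preserved by limits.
  refine ⟨⟨⟨⟨g, fun v w => ?_⟩, fun c v => ?_⟩, ?_, fun n A hA => ⟨?_, fun ξ => ?_⟩⟩, hg⟩
  · refine ext_inner_operator fun ξ η => hu (hg _ _ _) ?_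
    simpa [inner_add_right] using (hg v ξ η).add (hg w ξ η)
  · refine ext_inner_operator fun ξ η => hu (hg _ _ _) ?_
    simpa [inner_smul_right] using (hg v ξ η).const_mul c
  · refine ext_inner_operator fun ξ η => hu (hg _ _ _) ?_
    simp only [UCP.map_unit]
    exact tendsto_const_nhds
  · ext1 i j
    refine ext_inner_operator fun ξ η => hu ?_ (hg _ _ _)
    have h : A i j = star (A j i) := by
      rw [← Matrix.conjTranspose_apply, MatrixOrdered.isHermitian_of_mem hA]
    have h1 := (Complex.continuous_conj.tendsto _).comp (hg (A j i) η ξ)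
    simp only [Matrix.conjTranspose_apply, Matrix.map_apply, ContinuousLinearMap.star_eq_adjoint,
      ContinuousLinearMap.adjoint_inner_right, h, UCP.map_star]
    simpa [Function.comp_def] using h1
  · have h1 : Tendsto (fun i => opForm (A.map (f i)) ξ) U (𝓝 (opForm (A.map g) ξ)) :=
      tendsto_finsetSum _ fun k _ => tendsto_finsetSum _ fun l _ => hg (A k l) (ξ k) (ξ l)
    exact ge_of_tendsto' ((Complex.continuous_re.tendsto _).comp h1)
      fun i => ((f i).map_cone n A hA).2 ξ

/-- Left and right multiplication by a fixed operator are weakly continuous: `R` moves to the other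
side of the inner product as its adjoint, or is absorbed into the vector. -/
theorem commute_of_weak_limit {S : ι → K →L[ℂ] K} {T R : K →L[ℂ] K}
    (hT : ∀ ξ η, Tendsto (fun i => inner ℂ ξ (S i η)) U (𝓝 (inner ℂ ξ (T η))))
    (hR : ∀ i, R * S i = S i * R) : R * T = T * R := by
  refine ext_inner_operator fun ξ η => tendsto_nhds_unique ?_ (hT ξ (R η))
  have h := hT (R.adjoint ξ) η
  simp only [ContinuousLinearMap.adjoint_inner_left] at h
  refine h.congr fun i => ?_
  exact congrArg (inner ℂ ξ) (DFunLike.congr_fun (hR i) η)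

end WeakLimit

/-! ### Corestriction to subalgebras and compression of operators -/

section Subalgebra

variable {V : Type*} [AddCommGroup V] [Module ℂ V] [StarAddMonoid V] [StarModule ℂ V]
  [MatrixOrdered V] (M : StarSubalgebra ℂ (K →L[ℂ] K))

/-- The inclusion of a unital `*`-subalgebra of `B(K)`. -/
def UCP.inclusion : UCP M (K →L[ℂ] K) where
  toLin := M.subtype.toAlgHom.toLinearMap
  map_unit := rfl
  map_cone _ _ h := h

/-- A unital completely positive map into `B(K)` with values in a unital `*`-subalgebra. -/
def UCP.codRestrict (f : UCP V (K →L[ℂ] K)) (hf : ∀ v, f v ∈ M) : UCP V M where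
  toLin :=
    { toFun := fun v => ⟨f v, hf v⟩
      map_add' := fun v w => Subtype.ext (map_add f.toLin v w)
      map_smul' := fun c v => Subtype.ext (map_smul f.toLin c v) }
  map_unit := Subtype.ext f.map_unit
  map_cone n A hA := f.map_cone n A hA

/-- The compression `S ↦ c W* S W`, where `√c W` is an isometry. -/
def UCP.conj {L : Type*} [NormedAddCommGroup L] [InnerProductSpace ℂ L] [CompleteSpace L] (c : ℕ)
    (W : L →L[ℂ] K) (hW : (c : ℂ) • (W.adjoint ∘L W) = 1) : UCP (K →L[ℂ] K) (L →L[ℂ] L) where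
  toLin :=
    { toFun := fun S => (c : ℂ) • (W.adjoint ∘L S ∘L W)
      map_add' := fun S T => by ext; simp
      map_smul' := fun z S => by ext; simp [smul_comm z] }
  map_unit := hW
  map_cone n A hA := by
    refine ⟨?_, fun ξ => ?_⟩
    · ext1 i j
      have h : A i j = (A j i).adjoint := by
        rw [← ContinuousLinearMap.star_eq_adjoint, ← Matrix.conjTranspose_apply, hA.1]
      simp [h, ContinuousLinearMap.star_eq_adjoint, ContinuousLinearMap.adjoint_comp,
        ContinuousLinearMap.comp_assoc]
    -- The form of the compressed matrix at `ξ` is `c` times the form of the original one at the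
    -- vectors `W ξᵢ`.
    · have h : opForm (A.map fun S => (c : ℂ) • (W.adjoint ∘L S ∘L W)) ξ
          = ((c : ℝ) : ℂ) * opForm A fun i => W (ξ i) := by
        simp [opForm, ContinuousLinearMap.adjoint_inner_right, Finset.mul_sum]
      refine le_of_le_of_eq ?_ (congrArg Complex.re h).symm
      rw [Complex.re_ofReal_mul]
      exact mul_nonneg (Nat.cast_nonneg c) (hA.2 _)

end Subalgebra

end BoundedOperators

/-- For functions the dilation is tested pointwise: the scalar matrix with rows `(r, z)` and `(z̄,
r)` is positive when `|z| ≤ r`, its form being at least `r (|ξ₀| - |ξ₁|)²`. So UCP maps are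
contractive on `C(Ω)`, which is what permits arguments by density. -/
theorem UCP.norm_le_of_continuousMap {K : Type*} [NormedAddCommGroup K] [InnerProductSpace ℂ K]
    [CompleteSpace K] {Ω : Type*} [TopologicalSpace Ω] [CompactSpace Ω]
    (f : UCP C(Ω, ℂ) (K →L[ℂ] K)) {v : C(Ω, ℂ)} {r : ℝ} (hr : 0 < r) (h : ‖v‖ ≤ r) :
    ‖f v‖ ≤ r := by
  refine f.norm_le hr fun ω => ?_
  have hv : ‖v ω‖ ≤ r := (v.norm_coe_le_norm ω).trans h
  rw [posSemidef_iff_scalarOp]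
  refine ⟨?_, fun ξ => ?_⟩
  · ext1 i j
    fin_cases i <;> fin_cases j <;>
      simp [dilation, ← scalarOp_star, ordUnit]
  · have h1 : |((starRingEnd ℂ) (ξ 0) * (v ω * ξ 1)).re| ≤ r * (‖ξ 0‖ * ‖ξ 1‖) := by
      refine (Complex.abs_re_le_norm _).trans ?_
      simp only [norm_mul, RCLike.norm_conj]
      have := mul_le_mul_of_nonneg_right hv (mul_nonneg (norm_nonneg (ξ 0)) (norm_nonneg (ξ 1)))
      linarith
    have h3 : (opForm (((dilation ordUnit r v).map
        ({ toFun := fun f => f ω, map_add' := fun _ _ => rfl, map_smul' := fun _ _ => rfl } :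
          C(Ω, ℂ) →ₗ[ℂ] ℂ)).map scalarOp) ξ).re
        = r * ‖ξ 0‖ ^ 2 + 2 * ((starRingEnd ℂ) (ξ 0) * (v ω * ξ 1)).re + r * ‖ξ 1‖ ^ 2 := by
      simp [opForm, dilation, Fin.sum_univ_two, ordUnit, scalarOp_apply,
        ← Complex.normSq_eq_norm_sq, Complex.normSq_apply]
      ring
    have h4 := (abs_le.1 h1).1
    refine le_of_le_of_eq ?_ h3.symm
    nlinarith [sq_nonneg (‖ξ 0‖ - ‖ξ 1‖)]

/-! ### Cylinders: coordinates, measure, generation and density -/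

namespace InductiveFamily

variable (X : InductiveFamily)

/-- Stages are indexed from zero, so stage `n` records the `n + 1` coordinates `0, …, n`. -/
theorem proj_eq_iff {n : ℕ} {ω ω' : X.Omega} :
    X.proj n ω = X.proj n ω' ↔ ∀ i ≤ n, ω i = ω' i := by
  induction n with
  | zero => simp [proj]
  | succ n ih =>
    simp only [proj, EmbeddingLike.apply_eq_iff_eq, Prod.mk.injEq, ih]
    refine ⟨fun h i hi => ?_, fun h => ⟨fun i hi => h i (by omega), h _ le_rfl⟩⟩
    rcases Nat.le_succ_iff.1 hi with h' | rfl
    exacts [h.1 i h', h.2]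

theorem proj_eq_of_le {m n : ℕ} (h : m ≤ n) {ω ω' : X.Omega} (hω : X.proj n ω = X.proj n ω') :
    X.proj m ω = X.proj m ω' :=
  X.proj_eq_iff.2 fun i hi => X.proj_eq_iff.1 hω i (hi.trans h)

theorem proj_fst (n : ℕ) (ω : X.Omega) : (X.succEquiv n (X.proj (n + 1) ω)).1 = X.proj n ω := by
  simp [proj]

theorem proj_surjective (n : ℕ) : Function.Surjective (X.proj n) := by
  induction n with
  | zero => exact fun x => ⟨Function.update 0 0 (X.baseEquiv x), by simp [proj]⟩
  | succ n ih =>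
    intro x
    obtain ⟨ω, hω⟩ := ih (X.succEquiv n x).1
    refine ⟨Function.update ω (n + 1) (X.succEquiv n x).2, ?_⟩
    have : X.proj n (Function.update ω (n + 1) (X.succEquiv n x).2) = X.proj n ω :=
      X.proj_eq_iff.2 fun i hi => Function.update_of_ne (by omega) _ _
    simp [proj, this, hω]

/-- A point of the cylinder of `x`. -/
def extend (n : ℕ) (x : X.stage n) : X.Omega := (X.proj_surjective n x).choose

theorem proj_extend (n : ℕ) (x : X.stage n) : X.proj n (X.extend n x) = x :=
  (X.proj_surjective n x).choose_spec

theorem mem_cyl {n : ℕ} {x : X.stage n} {ω : X.Omega} : ω ∈ X.cyl n x ↔ X.proj n ω = x := Iff.rfl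

/-- As a box with finitely many constrained coordinates, the cylinder has a product measure that is
evaluated factor by factor. -/
theorem cyl_eq_pi (n : ℕ) (x : X.stage n) :
    X.cyl n x = Set.pi (Finset.range (n + 1)) fun i => {X.extend n x i} := by
  ext ω
  conv_lhs => rw [mem_cyl, ← X.proj_extend n x, proj_eq_iff]
  simp [Set.mem_pi]

theorem card_stage (n : ℕ) : Fintype.card (X.stage n) = ∏ i ∈ Finset.range (n + 1), X.d i := by
  induction n with
  | zero => simp [Fintype.card_congr X.baseEquiv]
  | succ n ih =>
    rw [Fintype.card_congr (X.succEquiv n), Fintype.card_prod, ih, Finset.prod_range_succ _ (n + 1),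
      Fintype.card_fin]

theorem card_stage_succ (n : ℕ) :
    Fintype.card (X.stage (n + 1)) = Fintype.card (X.stage n) * X.d (n + 1) := by
  rw [Fintype.card_congr (X.succEquiv n), Fintype.card_prod, Fintype.card_fin]

theorem measureReal_cyl (n : ℕ) (x : X.stage n) :
    X.mu.real (X.cyl n x) = (Fintype.card (X.stage n) : ℝ)⁻¹ := by
  rw [measureReal_def, mu, cyl_eq_pi, Measure.infinitePi_pi _ fun _ _ => measurableSet_singleton _,
    ENNReal.toReal_prod, card_stage]
  simp

/-- The `i`-th coordinate is a function of the projection to stage `i`, a finite set, and the fibres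
of that projection are cylinders; so the generated `σ`-algebra already makes every coordinate
measurable. -/
theorem generateFrom_cyl :
    (inferInstance : MeasurableSpace X.Omega)
      = MeasurableSpace.generateFrom {s | ∃ n x, s = X.cyl n x} := by
  refine le_antisymm ?_ (MeasurableSpace.generateFrom_le ?_)
  · refine iSup_le fun i => ?_
    rw [← measurable_iff_comap_le]
    have h1 : Measurable[MeasurableSpace.generateFrom {s | ∃ n x, s = X.cyl n x}, ⊤]
        (X.proj i) :=
      @measurable_to_countable' _ _ ⊤ _ (MeasurableSpace.generateFrom _) _
        fun x => MeasurableSpace.measurableSet_generateFrom ⟨i, x, rfl⟩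
    have h2 : (fun ω : X.Omega => ω i) = (fun x => X.extend i x i) ∘ X.proj i := by
      ext1 ω
      exact (X.proj_eq_iff.1 (X.proj_extend i (X.proj i ω)) i le_rfl).symm
    rw [h2]
    exact Measurable.comp measurable_from_top h1
  · rintro _ ⟨n, x, rfl⟩
    exact X.measurableSet_cyl n x

/-- Two cylinders are either disjoint or nested, the deeper one lying inside the other. -/
theorem isPiSystem_cyl : IsPiSystem {s | ∃ n x, s = X.cyl n x} := by
  have key : ∀ {m n : ℕ}, m ≤ n → ∀ (x : X.stage m) (y : X.stage n),
      (X.cyl m x ∩ X.cyl n y).Nonempty → X.cyl m x ∩ X.cyl n y = X.cyl n y := by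
    rintro m n hmn x y ⟨ω, hx, hy⟩
    exact Set.inter_eq_right.2 fun ω' hω' =>
      (X.proj_eq_of_le hmn (Eq.trans hω' (Eq.symm hy))).trans hx
  rintro _ ⟨m, x, rfl⟩ _ ⟨n, y, rfl⟩ h
  rcases le_total m n with hmn | hmn
  · exact ⟨n, y, key hmn x y h⟩
  · rw [Set.inter_comm] at h ⊢
    exact ⟨m, x, key hmn y x h⟩

/-- A continuous function on the Cantor space is a uniform limit of functions of finitely many
coordinates. -/
theorem exists_norm_sub_cantorIncl_le (f : C(X.Omega, ℂ)) {ε : ℝ} (hε : 0 < ε) :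
    ∃ (n : ℕ) (u : DiagAlg (X.stage n)), ‖f - X.cantorIncl n u‖ ≤ ε := by
  have hU : ∀ ω : X.Omega, ∃ n, ∀ ω' ∈ X.cyl n (X.proj n ω), dist (f ω') (f ω) < ε / 2 := by
    intro ω
    obtain ⟨V, hV, hω⟩ := mem_nhds_iff.1
      (f.continuous.continuousAt.preimage_mem_nhds (Metric.ball_mem_nhds (f ω) (half_pos hε)))
    obtain ⟨I, u, hu, hI⟩ := isOpen_pi_iff.1 hω.1 ω hω.2
    -- A basic neighbourhood constrains the finite set `I` of coordinates; the cylinder whose level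
    -- is the largest of them fixes all of `I`.
    refine ⟨I.sup id, fun ω' hω' => hV (hI fun i hi => ?_)⟩
    rw [X.proj_eq_iff.1 hω' i (Finset.le_sup (f := id) hi)]
    exact (hu i hi).2
  choose N hN using hU
  obtain ⟨t, ht⟩ := isCompact_univ.elim_finite_subcover
    (fun ω => X.cyl (N ω) (X.proj (N ω) ω))
    (fun ω => (X.isLocallyConstant_proj (N ω)).isOpen_fiber _)
    fun ω _ => Set.mem_iUnion.2 ⟨ω, rfl⟩
  -- At the deepest level of the finite subcover, `ω` and the chosen point of its cylinder lie in
  -- one common member of the cover. The two values of `f` are both within `ε / 2` of its value at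
  -- the centre `ω₀`.
  refine ⟨t.sup N, fun x => f (X.extend _ x), ?_⟩
  refine (ContinuousMap.norm_le _ hε.le).2 fun ω => ?_
  obtain ⟨ω₀, h₀, hω⟩ : ∃ ω₀ ∈ t, ω ∈ X.cyl (N ω₀) (X.proj (N ω₀) ω₀) := by
    simpa using ht (Set.mem_univ ω)
  have h1 := hN ω₀ ω hω
  have h2 := hN ω₀ (X.extend _ (X.proj (t.sup N) ω))
    ((X.proj_eq_of_le (Finset.le_sup h₀) (X.proj_extend _ _)).trans hω)
  have h3 := dist_triangle_right (f ω) (f (X.extend _ (X.proj (t.sup N) ω))) (f ω₀)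
  rw [dist_eq_norm] at h3
  change ‖f ω - f (X.extend _ (X.proj (t.sup N) ω))‖ ≤ ε
  linarith

end InductiveFamily

/-! ### The vectors `χ_x̃ ⊗ ξ` in `L²(Ω_X; H)` -/

section Cylinders

variable (X : InductiveFamily) {H : Type*} [NormedAddCommGroup H] [InnerProductSpace ℂ H]
  [CompleteSpace H]

theorem coeFn_cylEmbed (n : ℕ) (x : X.stage n) (ξ : H) :
    cylEmbed X n x ξ =ᵐ[X.mu] (X.cyl n x).indicator fun _ => ξ :=
  indicatorConstLp_coeFn (hs := X.measurableSet_cyl n x) (hμs := measure_ne_top X.mu _)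

theorem adjoint_cylEmbed_apply (n : ℕ) (x : X.stage n) (F : Lp H 2 X.mu) :
    (cylEmbed X n x).adjoint F = ∫ ω in X.cyl n x, F ω ∂X.mu := by
  refine ext_inner_left ℂ fun ξ => ?_
  rw [ContinuousLinearMap.adjoint_inner_right]
  exact L2.inner_indicatorConstLp_eq_inner_setIntegral ℂ (X.measurableSet_cyl n x)
    (measure_ne_top X.mu _) ξ F

/-- Distinct cylinders of one level are disjoint, and each has measure `1 / |Xₙ|`; this is the
origin of the factor `|Xₙ|` in the conditional expectation. -/
theorem adjoint_cylEmbed_cylEmbed (n : ℕ) (x y : X.stage n) (ξ : H) [Decidable (x = y)] :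
    (cylEmbed X n y).adjoint (cylEmbed X n x ξ)
      = if x = y then (Fintype.card (X.stage n) : ℂ)⁻¹ • ξ else 0 := by
  rw [adjoint_cylEmbed_apply, integral_congr_ae (ae_restrict_of_ae (coeFn_cylEmbed X n x ξ)),
    setIntegral_indicator (X.measurableSet_cyl n x), setIntegral_const]
  split_ifs with h
  · subst h
    rw [Set.inter_self, X.measureReal_cyl, ← Complex.coe_smul]
    simp
  · have : X.cyl n y ∩ X.cyl n x = ∅ :=
      Set.eq_empty_of_forall_notMem fun ω hω => h (hω.2.symm.trans hω.1)
    simp [this]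

theorem adjoint_cylEmbed_comp_self (n : ℕ) (x : X.stage n) :
    (cylEmbed X n x).adjoint ∘L (cylEmbed X n x : H →L[ℂ] Lp H 2 X.mu)
      = (Fintype.card (X.stage n) : ℂ)⁻¹ • 1 := by
  classical
  ext ξ
  simp [adjoint_cylEmbed_cylEmbed]

/-- The cylinder of `x` is the disjoint union of the cylinders of its children `(x, k)`; at a point
`ω` of it, only the child with `k = ω (n + 1)` contributes. -/
theorem cylEmbed_eq_sum (n : ℕ) (x : X.stage n) (ξ : H) :
    cylEmbed X n x ξ = ∑ k, cylEmbed X (n + 1) ((X.succEquiv n).symm (x, k)) ξ := by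
  ext1
  have h1 : ∀ᵐ ω ∂X.mu, ∀ k, cylEmbed X (n + 1) ((X.succEquiv n).symm (x, k)) ξ ω
      = (X.cyl (n + 1) ((X.succEquiv n).symm (x, k))).indicator (fun _ => ξ) ω :=
    ae_all_iff.2 fun k => coeFn_cylEmbed X (n + 1) _ ξ
  filter_upwards [coeFn_cylEmbed X n x ξ, h1, Lp.coeFn_finsetSum (Finset.univ)
    (fun k => cylEmbed X (n + 1) ((X.succEquiv n).symm (x, k)) ξ)] with ω h1 h2 h3
  rw [h1, h3, Finset.sum_apply, Finset.sum_congr rfl fun k _ => h2 k]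
  have h4 : ∀ k, ω ∈ X.cyl (n + 1) ((X.succEquiv n).symm (x, k)) ↔ X.proj n ω = x ∧ ω (n + 1) = k :=
    fun k => by simp [InductiveFamily.mem_cyl, InductiveFamily.proj]
  by_cases h : X.proj n ω = x
  · rw [Set.indicator_of_mem (X.mem_cyl.2 h), Finset.sum_eq_single (ω (n + 1)),
      Set.indicator_of_mem ((h4 _).2 ⟨h, rfl⟩)]
    · exact fun k _ hk => Set.indicator_of_notMem (fun hω => hk ((h4 k).1 hω).2.symm) _
    · simp
  · rw [Set.indicator_of_notMem fun hω => h (X.mem_cyl.1 hω), Finset.sum_eq_zero]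
    exact fun k _ => Set.indicator_of_notMem (fun hω => h ((h4 k).1 hω).1) _

/-- An element of `L²(Ω_X; H)` that is orthogonal to all `χ_x̃ ⊗ ξ` is zero. -/
theorem eq_zero_of_adjoint_cylEmbed {F : Lp H 2 X.mu}
    (h : ∀ n x, (cylEmbed X n x).adjoint F = 0) : F = 0 := by
  have hF : Integrable F X.mu := (Lp.memLp F).integrable one_le_two
  -- The integral over the whole space, obtained from the partition into cylinders of level zero, is
  -- needed for complements in the π-λ induction below.
  have h0 : ∫ ω, F ω ∂X.mu = 0 := by
    have h1 : ∀ x, ∫ ω in X.cyl 0 x, F ω ∂X.mu = 0 := fun x => by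
      rw [← adjoint_cylEmbed_apply, h]
    rw [← setIntegral_univ, ← Set.iUnion_eq_univ_iff.2 fun ω => ⟨X.proj 0 ω, X.mem_cyl.2 rfl⟩,
      integral_iUnion_fintype (X.measurableSet_cyl 0) _ fun x => hF.integrableOn]
    · simp [h1]
    · exact fun x y hxy => Set.disjoint_left.2 fun ω hx hy => hxy (hx.symm.trans hy)
  refine Lp.ext ?_
  refine (hF.ae_eq_zero_of_forall_setIntegral_eq_zero fun s hs hμ => ?_).trans
    (Lp.coeFn_zero ..).symm
  clear hμ
  induction s, hs using MeasurableSpace.induction_on_inter X.generateFrom_cyl X.isPiSystem_cyl with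
  | empty => simp
  | basic t ht =>
    obtain ⟨n, x, rfl⟩ := ht
    rw [← adjoint_cylEmbed_apply, h]
  | compl t ht ih =>
    have := integral_add_compl ht hF
    rwa [ih, zero_add, h0] at this
  | iUnion f hd hm ih =>
    rw [integral_iUnion hm hd hF.integrableOn]
    simp [ih]

/-- The spans `V n` of the cylinder vectors increase with `n`, so any two step vectors lie in a
common one, where the form of `D` vanishes. Totality of the step vectors is then applied twice:
first the adjoint of `D` kills every step vector, and therefore `D F` is orthogonal to all of them
for every `F`. -/
theorem eq_zero_of_adjoint_cylEmbed_comp {D : Lp H 2 X.mu →L[ℂ] Lp H 2 X.mu}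
    (h : ∀ n x y ξ, (cylEmbed X n x).adjoint (D (cylEmbed X n y ξ)) = 0) : D = 0 := by
  let V : ℕ → Submodule ℂ (Lp H 2 X.mu) := fun n =>
    ⨆ x, LinearMap.range (cylEmbed X n x : H →L[ℂ] Lp H 2 X.mu).toLinearMap
  have hmem : ∀ n x ξ, cylEmbed X n x ξ ∈ V n := fun n x ξ =>
    Submodule.mem_iSup_of_mem x ⟨ξ, rfl⟩
  have hV : Monotone V := monotone_nat_of_le_succ fun n => iSup_le fun x => by
    rintro _ ⟨ξ, rfl⟩
    change cylEmbed X n x ξ ∈ _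
    rw [cylEmbed_eq_sum]
    exact sum_mem fun k _ => hmem _ _ _
  have hD : ∀ n, ∀ F ∈ V n, ∀ G ∈ V n, inner ℂ F (D G) = 0 := by
    intro n F hF G hG
    refine Submodule.iSup_induction (motive := fun F => inner ℂ F (D G) = 0) _ hF ?_ (by simp)
      fun F F' hF hF' => by rw [inner_add_left, hF, hF', add_zero]
    rintro x _ ⟨ξ, rfl⟩
    refine Submodule.iSup_induction (motive := fun G => inner ℂ _ (D G) = 0) _ hG ?_ (by simp)
      fun G G' hG hG' => by rw [map_add, inner_add_right, hG, hG', add_zero]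
    rintro y _ ⟨η, rfl⟩
    change inner ℂ (cylEmbed X n x ξ) (D (cylEmbed X n y η)) = 0
    rw [← ContinuousLinearMap.adjoint_inner_right, h, inner_zero_right]
  have hD' : ∀ m, ∀ F ∈ V m, D.adjoint F = 0 := fun m F hF =>
    eq_zero_of_adjoint_cylEmbed X fun n x => ext_inner_left ℂ fun ξ => by
      rw [ContinuousLinearMap.adjoint_inner_right, ContinuousLinearMap.adjoint_inner_right,
        ← inner_conj_symm, hD (max m n) F (hV (le_max_left _ _) hF) _
        (hV (le_max_right _ _) (hmem n x ξ)), map_zero, inner_zero_right]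
  ext1 F
  refine eq_zero_of_adjoint_cylEmbed X fun n x => ext_inner_left ℂ fun ξ => ?_
  rw [ContinuousLinearMap.adjoint_inner_right, ← ContinuousLinearMap.adjoint_inner_left,
    hD' n _ (hmem n x ξ), inner_zero_left, inner_zero_right]

/-! ### Operator-valued step functions acting on `L²(Ω_X; H)` -/

theorem memLp_mulOp (n : ℕ) (T : X.stage n → H →L[ℂ] H) (F : Lp H 2 X.mu) :
    MemLp (fun ω => T (X.proj n ω) (F ω)) 2 X.mu := by
  refine (Lp.memLp F).of_le_mul (c := ∑ x, ‖T x‖) ?_ (Eventually.of_forall fun ω => ?_)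
  -- The operator takes only finitely many values, so measurability reduces to that of a single
  -- bounded operator applied to `F` and cut off to a cylinder.
  · have : (fun ω => T (X.proj n ω) (F ω))
        = ∑ x, (X.cyl n x).indicator fun ω => T x (F ω) := by
      ext ω
      classical
      simp [Finset.sum_apply, Set.indicator_apply, X.mem_cyl]
    rw [this]
    exact Finset.aestronglyMeasurable_sum _ fun x _ =>
      ((T x).continuous.comp_aestronglyMeasurable (Lp.aestronglyMeasurable F)).indicator
        (X.measurableSet_cyl n x)
  · exact (T _).le_of_opNorm_le (Finset.single_le_sum (f := fun x => ‖T x‖)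
      (fun _ _ => norm_nonneg _) (Finset.mem_univ _)) _

/-- The operator `∑ₓ χ_x̃ ⊗ T(x)` on `L²(Ω_X; H)`. -/
def mulOp (n : ℕ) (T : X.stage n → H →L[ℂ] H) : Lp H 2 X.mu →L[ℂ] Lp H 2 X.mu :=
  LinearMap.mkContinuous
    { toFun := fun F => (memLp_mulOp X n T F).toLp
      map_add' := fun F G => by
        ext1
        filter_upwards [(memLp_mulOp X n T F).coeFn_toLp, (memLp_mulOp X n T G).coeFn_toLp,
          (memLp_mulOp X n T (F + G)).coeFn_toLp, Lp.coeFn_add F G,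
          Lp.coeFn_add (memLp_mulOp X n T F).toLp (memLp_mulOp X n T G).toLp] with ω h1 h2 h3 h4 h5
        rw [h3, h4, h5, Pi.add_apply, Pi.add_apply, map_add, h1, h2]
      map_smul' := fun c F => by
        ext1
        filter_upwards [(memLp_mulOp X n T F).coeFn_toLp, (memLp_mulOp X n T (c • F)).coeFn_toLp,
          Lp.coeFn_smul c F, Lp.coeFn_smul c (memLp_mulOp X n T F).toLp] with ω h1 h2 h3 h4
        rw [h2, h3, RingHom.id_apply, h4, Pi.smul_apply, Pi.smul_apply, map_smul, h1] }
    (∑ x, ‖T x‖) fun F => by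
      refine Lp.norm_le_mul_norm_of_ae_le_mul ?_
      filter_upwards [(memLp_mulOp X n T F).coeFn_toLp] with ω h
      refine (congrArg norm h).trans_le ?_
      exact (T _).le_of_opNorm_le (Finset.single_le_sum (f := fun x => ‖T x‖)
        (fun _ _ => norm_nonneg _) (Finset.mem_univ _)) _

theorem coeFn_mulOp (n : ℕ) (T : X.stage n → H →L[ℂ] H) (F : Lp H 2 X.mu) :
    mulOp X n T F =ᵐ[X.mu] fun ω => T (X.proj n ω) (F ω) :=
  (memLp_mulOp X n T F).coeFn_toLp

theorem mulOp_add (n : ℕ) (T T' : X.stage n → H →L[ℂ] H) :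
    mulOp X n (T + T') = mulOp X n T + mulOp X n T' := by
  ext1 F
  ext1
  filter_upwards [coeFn_mulOp X n T F, coeFn_mulOp X n T' F, coeFn_mulOp X n (T + T') F,
    Lp.coeFn_add (mulOp X n T F) (mulOp X n T' F)] with ω h1 h2 h3 h4
  exact h3.trans (Eq.trans (congrArg₂ (· + ·) h1 h2).symm h4.symm)

theorem mulOp_smul (n : ℕ) (c : ℂ) (T : X.stage n → H →L[ℂ] H) :
    mulOp X n (c • T) = c • mulOp X n T := by
  ext1 F
  ext1
  filter_upwards [coeFn_mulOp X n T F, coeFn_mulOp X n (c • T) F,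
    Lp.coeFn_smul c (mulOp X n T F)] with ω h1 h2 h3
  exact h2.trans (Eq.trans (congrArg (c • ·) h1).symm h3.symm)

theorem mulOp_one (n : ℕ) : mulOp X n (1 : X.stage n → H →L[ℂ] H) = 1 := by
  ext1 F
  ext1
  exact coeFn_mulOp X n 1 F

/-- `mulOp` as a linear map. -/
def mulOpLin (n : ℕ) :
    (X.stage n → H →L[ℂ] H) →ₗ[ℂ] (Lp H 2 X.mu →L[ℂ] Lp H 2 X.mu) where
  toFun := mulOp X n
  map_add' := mulOp_add X n
  map_smul' := mulOp_smul X n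

theorem inner_mulOp (n : ℕ) (T : X.stage n → H →L[ℂ] H) (F G : Lp H 2 X.mu) :
    inner ℂ F (mulOp X n T G) = ∫ ω, inner ℂ (F ω) (T (X.proj n ω) (G ω)) ∂X.mu := by
  rw [L2.inner_def]
  refine integral_congr_ae ?_
  filter_upwards [coeFn_mulOp X n T G] with ω h
  rw [h]

theorem integrable_inner_mulOp (n : ℕ) (T : X.stage n → H →L[ℂ] H) (F G : Lp H 2 X.mu) :
    Integrable (fun ω => inner ℂ (F ω) (T (X.proj n ω) (G ω))) X.mu := by
  refine (L2.integrable_inner (𝕜 := ℂ) F (mulOp X n T G)).congr ?_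
  filter_upwards [coeFn_mulOp X n T G] with ω h
  rw [h]

theorem star_mulOp (n : ℕ) (T : X.stage n → H →L[ℂ] H) :
    star (mulOp X n T) = mulOp X n (star T) := by
  refine ext_inner_operator fun F G => ?_
  rw [ContinuousLinearMap.star_eq_adjoint, ContinuousLinearMap.adjoint_inner_right,
    ← inner_conj_symm, inner_mulOp, inner_mulOp, ← integral_conj]
  refine integral_congr_ae (Eventually.of_forall fun ω => ?_)
  simp [ContinuousLinearMap.star_eq_adjoint, ContinuousLinearMap.adjoint_inner_right]

/-- The map `v ↦ ∑ₓ χ_x̃ ⊗ fₓ(v)`. -/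
def UCP.mulOp {V : Type*} [AddCommGroup V] [Module ℂ V] [StarAddMonoid V] [StarModule ℂ V]
    [MatrixOrdered V] (n : ℕ) (f : X.stage n → UCP V (H →L[ℂ] H)) :
    UCP V (Lp H 2 X.mu →L[ℂ] Lp H 2 X.mu) where
  toLin := mulOpLin X n ∘ₗ LinearMap.pi fun x => (f x).toLin
  map_unit := by
    refine Eq.trans ?_ (mulOp_one X n)
    exact congrArg (CantorOpSys.mulOp X n) (funext fun x => (f x).map_unit)
  map_cone k A hA := by
    refine ⟨?_, fun ξ => ?_⟩
    · ext1 i j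
      have h : A i j = star (A j i) := by
        rw [← Matrix.conjTranspose_apply, MatrixOrdered.isHermitian_of_mem hA]
      refine (star_mulOp X n _).trans (congrArg (CantorOpSys.mulOp X n) (funext fun x => ?_))
      change star (f x (A j i)) = f x (A i j)
      rw [h, UCP.map_star]
    -- The form on `L²(Ω_X; H)ᵏ` is the integral over `ω` of the forms on `Hᵏ` of the matrices
    -- attached to the cylinder of `ω`; these are positive for every `ω`.
    · have h : opForm (A.map (mulOpLin X n ∘ₗ LinearMap.pi fun x => (f x).toLin)) ξ
          = ∫ ω, opForm (A.map (f (X.proj n ω))) (fun i => ξ i ω) ∂X.mu := by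
        refine Eq.trans ?_ (integral_finsetSum _ fun i _ => integrable_finsetSum _ fun j _ =>
          integrable_inner_mulOp X n (fun x => f x (A i j)) (ξ i) (ξ j)).symm
        refine Finset.sum_congr rfl fun i _ => ?_
        refine Eq.trans ?_ (integral_finsetSum _ fun j _ =>
          integrable_inner_mulOp X n (fun x => f x (A i j)) (ξ i) (ξ j)).symm
        exact Finset.sum_congr rfl fun j _ => inner_mulOp X n _ _ _
      rw [h, ← Complex.reCLM_apply, ← Complex.reCLM.integral_comp_comm]
      · exact integral_nonneg fun ω => ((f _).map_cone k A hA).2 _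
      · exact integrable_finsetSum _ fun i _ => integrable_finsetSum _ fun j _ =>
          integrable_inner_mulOp X n (fun x => f x (A i j)) (ξ i) (ξ j)

theorem mulOp_cylEmbed (n : ℕ) (T : X.stage n → H →L[ℂ] H) (x : X.stage n) (ξ : H) :
    mulOp X n T (cylEmbed X n x ξ) = cylEmbed X n x (T x ξ) := by
  ext1
  filter_upwards [coeFn_mulOp X n T (cylEmbed X n x ξ), coeFn_cylEmbed X n x ξ,
    coeFn_cylEmbed X n x (T x ξ)] with ω h1 h2 h3
  rw [h1, h2, h3]
  by_cases h : ω ∈ X.cyl n x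
  · simp [h, X.mem_cyl.1 h]
  · simp [h]

/-! ### Membership in `L^∞(Ω_X) ⊗̄ B(H)` and the block-diagonal form of its elements -/

theorem mulOp_single_mem_elementaryTensors [∀ n, DecidableEq (X.stage n)] (n : ℕ) (x : X.stage n)
    (T : H →L[ℂ] H) : mulOp X n (Pi.single x T) ∈ elementaryTensors X.mu H := by
  refine ⟨(X.cyl n x).indicator 1, T,
    (memLp_const (1 : ℂ)).indicator (X.measurableSet_cyl n x), fun F => ?_⟩
  filter_upwards [coeFn_mulOp X n (Pi.single x T) F] with ω h
  rw [h]
  by_cases hx : X.proj n ω = x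
  · subst hx
    simp [X.mem_cyl]
  · simp [X.mem_cyl, hx]

/-- A set lies in its double commutant. The centralizer here demands commutation with adjoints too;
that half follows on taking adjoints in the relation between `R` and the adjoint of `W`. -/
theorem elementaryTensors_subset :
    elementaryTensors X.mu H ⊆ (LinftyTensor X.mu H).toStarSubalgebra := fun W hW =>
  (StarSubalgebra.mem_centralizer_iff ℂ).2 fun R hR => by
    obtain ⟨h1, h2⟩ := (StarSubalgebra.mem_centralizer_iff ℂ).1 hR W hW
    refine ⟨h1.symm, ?_⟩
    have := congrArg star h2
    simpa using this

theorem mulOp_mem (n : ℕ) (T : X.stage n → H →L[ℂ] H) :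
    mulOp X n T ∈ (LinftyTensor X.mu H).toStarSubalgebra := by
  classical
  have : mulOp X n T = ∑ x, mulOp X n (Pi.single x (T x)) := by
    conv_lhs => rw [← Finset.univ_sum_single T]
    exact map_sum (mulOpLin X n) _ _
  rw [this]
  exact sum_mem fun x _ => elementaryTensors_subset X (mulOp_single_mem_elementaryTensors X n x _)

/-- The algebra is a commutant, and each commutation relation survives weak limits. -/
theorem mem_of_weak_limit {ι : Type*} (U : Ultrafilter ι) {S : ι → ChannelAlg X H}
    {T : Lp H 2 X.mu →L[ℂ] Lp H 2 X.mu}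
    (hT : ∀ F G, Tendsto (fun i => inner ℂ F ((S i : Lp H 2 X.mu →L[ℂ] Lp H 2 X.mu) G)) U
      (𝓝 (inner ℂ F (T G)))) : T ∈ (LinftyTensor X.mu H).toStarSubalgebra :=
  (StarSubalgebra.mem_centralizer_iff ℂ).2 fun R hR =>
    ⟨commute_of_weak_limit U hT fun i =>
      ((StarSubalgebra.mem_centralizer_iff ℂ).1 (S i).2 R hR).1,
    commute_of_weak_limit U hT fun i =>
      ((StarSubalgebra.mem_centralizer_iff ℂ).1 (S i).2 R hR).2⟩

/-- Multiplication by the scalar function `χ_x̃` commutes with every `M_f ⊗ T`. It is self-adjoint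
and so belongs to the commutant of the generators, with which elements of the double commutant
commute. -/
theorem commute_mulOp_single [∀ n, DecidableEq (X.stage n)] (S : ChannelAlg X H) (n : ℕ)
    (x : X.stage n) :
    mulOp X n (Pi.single x 1) * (S : Lp H 2 X.mu →L[ℂ] Lp H 2 X.mu)
      = (S : Lp H 2 X.mu →L[ℂ] Lp H 2 X.mu) * mulOp X n (Pi.single x 1) := by
  have hs : star (mulOp X n (Pi.single x (1 : H →L[ℂ] H))) = mulOp X n (Pi.single x 1) := by
    rw [star_mulOp]
    congr 1
    ext1 y
    by_cases h : y = x
    · subst h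
      simp
    · simp [h]
  have hc : ∀ W ∈ elementaryTensors X.mu H, W * mulOp X n (Pi.single x (1 : H →L[ℂ] H))
      = mulOp X n (Pi.single x 1) * W := by
    rintro W ⟨f, T, -, hW⟩
    ext1 F
    ext1
    filter_upwards [hW (mulOp X n (Pi.single x 1) F), coeFn_mulOp X n (Pi.single x 1) F,
      coeFn_mulOp X n (Pi.single x 1) (W F), hW F] with ω h1 h2 h3 h4
    refine h1.trans (Eq.trans ?_ h3.symm)
    rw [h2, h4]
    by_cases h : X.proj n ω = x
    · subst h
      simp
    · simp [h]
  refine ((StarSubalgebra.mem_centralizer_iff ℂ).1 S.2 _ ?_).1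
  refine (StarSubalgebra.mem_centralizer_iff ℂ).2 fun W hW => ⟨hc W hW, ?_⟩
  have := congrArg star (hc W hW)
  rw [star_mul, star_mul, hs] at this
  exact this.symm

/-- Since `S` commutes with multiplication by `χ_ỹ`, it maps `χ_ỹ ⊗ ξ` to a vector supported on the
cylinder of `y`, which is orthogonal to everything supported on the cylinder of `x`. -/
theorem adjoint_cylEmbed_channel (S : ChannelAlg X H) {n : ℕ} {x y : X.stage n} (h : x ≠ y)
    (ξ : H) : (cylEmbed X n x).adjoint ((S : Lp H 2 X.mu →L[ℂ] Lp H 2 X.mu) (cylEmbed X n y ξ))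
      = 0 := by
  classical
  have h1 : cylEmbed X n y ξ = mulOp X n (Pi.single y 1) (cylEmbed X n y ξ) := by
    simp [mulOp_cylEmbed]
  have h2 := DFunLike.congr_fun (commute_mulOp_single X S n y) (cylEmbed X n y ξ)
  have hs : (mulOp X n (Pi.single y (1 : H →L[ℂ] H))).adjoint = mulOp X n (Pi.single y 1) := by
    rw [← ContinuousLinearMap.star_eq_adjoint, star_mulOp]
    congr 1
    ext1 z
    by_cases h : z = y
    · subst h
      simp
    · simp [h]
  refine ext_inner_left ℂ fun η => ?_
  rw [ContinuousLinearMap.adjoint_inner_right, h1, inner_zero_right]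
  refine (congrArg (inner ℂ (cylEmbed X n x η)) h2.symm).trans ?_
  rw [mul_apply_eq_comp, ← ContinuousLinearMap.adjoint_inner_left, hs, mulOp_cylEmbed]
  simp [h]

end Cylinders

/-! ### Conditional expectations and the martingale relation -/

section CondExpect

variable (X : InductiveFamily) {H : Type*} [NormedAddCommGroup H] [InnerProductSpace ℂ H]
  [CompleteSpace H]

theorem card_smul_adjoint_cylEmbed_comp_self (n : ℕ) (x : X.stage n) :
    (Fintype.card (X.stage n) : ℂ) •
      ((cylEmbed X n x).adjoint ∘L (cylEmbed X n x : H →L[ℂ] Lp H 2 X.mu)) = 1 := by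
  rw [adjoint_cylEmbed_comp_self, smul_inv_smul₀]
  exact Nat.cast_ne_zero.2 Fintype.card_ne_zero

variable (H) in
/-- The inclusion of `L^∞(Ω_X) ⊗̄ B(H)` into `B(L²(Ω_X; H))`. -/
def channelIncl : UCP (ChannelAlg X H) (Lp H 2 X.mu →L[ℂ] Lp H 2 X.mu) :=
  UCP.inclusion (LinftyTensor X.mu H).toStarSubalgebra

/-- The compression of operators on `L²(Ω_X; H)` to the cylinder of `x`. -/
def cylCompression (n : ℕ) (x : X.stage n) :
    UCP (Lp H 2 X.mu →L[ℂ] Lp H 2 X.mu) (H →L[ℂ] H) :=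
  UCP.conj (Fintype.card (X.stage n)) (cylEmbed X n x : H →L[ℂ] Lp H 2 X.mu)
    (card_smul_adjoint_cylEmbed_comp_self X n x)

/-- The component of the conditional expectation at `x`, as a unital completely positive map. -/
def UCP.condExpect (n : ℕ) (x : X.stage n) : UCP (ChannelAlg X H) (H →L[ℂ] H) :=
  (cylCompression (H := H) X n x).comp (channelIncl X H)

theorem condExpect_apply (n : ℕ) (x : X.stage n) (S : ChannelAlg X H) (ξ : H) :
    condExpect X n S x ξ = (Fintype.card (X.stage n) : ℂ) •
      (cylEmbed X n x).adjoint ((S : Lp H 2 X.mu →L[ℂ] Lp H 2 X.mu) (cylEmbed X n x ξ)) := rfl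

/-- Both copies of `χ_x̃` are split over the children of `x`, and the cross terms vanish because `S`
is block diagonal. The factor is `|Xₙ| / |Xₙ₊₁| = 1 / d`. -/
theorem condExpect_eq_average (n : ℕ) (x : X.stage n) (S : ChannelAlg X H) :
    condExpect X n S x = (((X.d (n + 1) : ℝ)⁻¹ : ℝ) : ℂ) •
      ∑ k, condExpect X (n + 1) S ((X.succEquiv n).symm (x, k)) := by
  ext1 ξ
  refine ext_inner_left ℂ fun η => ?_
  rw [smul_apply, sum_apply]
  simp only [condExpect_apply, inner_smul_right, inner_sum,
    ContinuousLinearMap.adjoint_inner_right, cylEmbed_eq_sum X n x, map_sum, sum_inner]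
  have h : ∀ k l, k ≠ l → inner ℂ (cylEmbed X (n + 1) ((X.succEquiv n).symm (x, k)) η)
      ((S : Lp H 2 X.mu →L[ℂ] Lp H 2 X.mu) (cylEmbed X (n + 1) ((X.succEquiv n).symm (x, l)) ξ))
      = 0 := fun k l hkl => by
    rw [← ContinuousLinearMap.adjoint_inner_right, adjoint_cylEmbed_channel X S, inner_zero_right]
    simpa using hkl
  rw [← Finset.mul_sum, ← mul_assoc, Finset.sum_comm, X.card_stage_succ]
  have hd : (X.d (n + 1) : ℂ) ≠ 0 := Nat.cast_ne_zero.2 (NeZero.ne _)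
  congr 1
  · push_cast
    field_simp
  · exact Finset.sum_congr rfl fun k _ =>
      Finset.sum_eq_single k (fun l _ hl => h k l hl.symm) (by simp)

/-- The elements of `L^∞(Ω_X) ⊗̄ B(H)` are determined by their conditional expectations. -/
theorem channel_ext {S S' : ChannelAlg X H} (h : ∀ n x, condExpect X n S x = condExpect X n S' x) :
    S = S' := by
  refine Subtype.ext (sub_eq_zero.1 (eq_zero_of_adjoint_cylEmbed_comp X fun n x y ξ => ?_))
  rw [sub_apply, map_sub]
  -- Diagonal blocks are the expectations up to the nonzero factor `|Xₙ|`; off-diagonal blocks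
  -- vanish for both operators.
  by_cases hxy : x = y
  · subst hxy
    have h1 := DFunLike.congr_fun (h n x) ξ
    rw [condExpect_apply, condExpect_apply] at h1
    exact sub_eq_zero.2 (smul_right_injective H (Nat.cast_ne_zero.2 Fintype.card_ne_zero) h1)
  · rw [adjoint_cylEmbed_channel X S hxy, adjoint_cylEmbed_channel X S' hxy, sub_zero]

theorem condExpect_mulOp (n : ℕ) (T : X.stage n → H →L[ℂ] H) (x : X.stage n) :
    condExpect X n ⟨mulOp X n T, mulOp_mem X n T⟩ x = T x := by
  classical
  ext1 ξ
  rw [condExpect_apply, mulOp_cylEmbed, adjoint_cylEmbed_cylEmbed, if_pos rfl,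
    smul_inv_smul₀ (Nat.cast_ne_zero.2 Fintype.card_ne_zero)]

/-- A matrix-valued martingale is recovered from its later terms by conditional expectations. -/
theorem condExpect_mulOp_of_le {m n : ℕ} (hmn : m ≤ n) (T : ∀ j, X.stage j → H →L[ℂ] H)
    (hT : ∀ j, m ≤ j → ∀ x, T j x = (((X.d (j + 1) : ℝ)⁻¹ : ℝ) : ℂ) •
      ∑ k, T (j + 1) ((X.succEquiv j).symm (x, k))) (x : X.stage m) :
    condExpect X m ⟨mulOp X n (T n), mulOp_mem X n (T n)⟩ x = T m x := by
  -- The induction descends from level `n`, where the expectation returns the step function itself.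
  -- Each step down averages both sides over the children.
  suffices h : ∀ j (_ : j ≤ n), m ≤ j → ∀ x,
      condExpect X j ⟨mulOp X n (T n), mulOp_mem X n (T n)⟩ x = T j x from h m hmn le_rfl x
  intro j hj
  induction hj using Nat.decreasingInduction with
  | self => exact fun _ x => condExpect_mulOp X n (T n) x
  | of_succ j hj ih =>
    intro hm x
    rw [condExpect_eq_average, hT j hm]
    simp only [ih (Nat.le_succ_of_le hm)]

/-- A coefficient of the expectation is a fixed multiple of a coefficient of the operator at two
cylinder vectors. -/
theorem tendsto_condExpect {ι : Type*} {l : Filter ι} {S : ι → ChannelAlg X H}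
    {T : ChannelAlg X H} (h : ∀ F G,
      Tendsto (fun i => inner ℂ F ((S i : Lp H 2 X.mu →L[ℂ] Lp H 2 X.mu) G)) l
        (𝓝 (inner ℂ F ((T : Lp H 2 X.mu →L[ℂ] Lp H 2 X.mu) G))))
    (n : ℕ) (x : X.stage n) (ξ η : H) :
    Tendsto (fun i => inner ℂ ξ (condExpect X n (S i) x η)) l
      (𝓝 (inner ℂ ξ (condExpect X n T x η))) := by
  simp only [condExpect_apply, inner_smul_right, ContinuousLinearMap.adjoint_inner_right]
  exact (h _ _).const_mul _

end CondExpect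

/-! ### The correspondence between `Γ` and `Φ` -/

section Cantor

variable (X A : InductiveFamily) {H : Type*} [NormedAddCommGroup H] [InnerProductSpace ℂ H]
  [CompleteSpace H]

/-- This is the formula that characterizes `γₙ`, with `A.diagIncl n u` in the role of `u ⊗ I`. -/
theorem gamma_ι (n : ℕ) (x : X.stage n) (u : DiagAlg (A.stage n)) :
    gamma X A n (Coproduct.ι (fun _ => DiagAlg (A.stage n)) x u)
      = (((X.d (n + 1) : ℝ)⁻¹ : ℝ) : ℂ) • ∑ k, Coproduct.ι (fun _ => DiagAlg (A.stage (n + 1)))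
        ((X.succEquiv n).symm (x, k)) (A.diagIncl n u) := by
  rw [gamma, UCP.comp_apply, refineOutputs, Coproduct.map, Coproduct.desc_ι, UCP.comp_apply,
    averageInputs, Coproduct.desc_ι]
  change ((((X.d (n + 1) : ℝ)⁻¹ : ℝ) : ℂ) • ∑ k, (Coproduct.ι (fun _ => DiagAlg (A.stage (n + 1)))
    ((X.succEquiv n).symm (x, k))).toLin) _ = _
  rw [LinearMap.smul_apply, LinearMap.sum_apply]

/-- In the limit an element is identified with its image under `γₙ`; applying `Γ` turns this
identity into the martingale relation for `x ↦ Γ(γ⁽ⁿ⁾(ι_x(u)))`. -/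
theorem gammaIncl_ι (n : ℕ) (x : X.stage n) (u : DiagAlg (A.stage n)) :
    gammaIncl X A n (Coproduct.ι (fun _ => DiagAlg (A.stage n)) x u)
      = (((X.d (n + 1) : ℝ)⁻¹ : ℝ) : ℂ) • ∑ k, gammaIncl X A (n + 1)
        (Coproduct.ι (fun _ => DiagAlg (A.stage (n + 1)))
          ((X.succEquiv n).symm (x, k)) (A.diagIncl n u)) := by
  rw [gammaIncl, ← InductiveLimit.ι_comp, gamma_ι, map_smul, map_sum]
  rfl

theorem cantorIncl_diagIncl (n : ℕ) (u : DiagAlg (A.stage n)) :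
    A.cantorIncl (n + 1) (A.diagIncl n u) = A.cantorIncl n u :=
  ContinuousMap.ext fun ω => congrArg u (A.proj_fst n ω)

/-- The evaluation of a continuous function at one point of each cylinder. -/
def InductiveFamily.sample (n : ℕ) : UCP C(A.Omega, ℂ) (DiagAlg (A.stage n)) where
  toLin :=
    { toFun := fun f a => f (A.extend n a)
      map_add' := fun _ _ => rfl
      map_smul' := fun _ _ => rfl }
  map_unit := rfl
  map_cone _ _ hB a := hB (A.extend n a)

theorem sample_cantorIncl_self (n : ℕ) (u : DiagAlg (A.stage n)) :
    A.sample n (A.cantorIncl n u) = u :=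
  funext fun a => congrArg u (A.proj_extend n a)

/-- A function of the coordinates up to `m` is constant on cylinders of level `n ≥ m`, so the
sampled values do not depend on the points chosen in them. -/
theorem sample_cantorIncl_succ {m n : ℕ} (h : m ≤ n) (u : DiagAlg (A.stage m)) :
    A.sample (n + 1) (A.cantorIncl m u) = A.diagIncl n (A.sample n (A.cantorIncl m u)) :=
  funext fun a => congrArg u <| A.proj_eq_of_le h <| by
    rw [A.proj_extend, ← A.proj_fst, A.proj_extend]

variable {A}

/-- Every element of the limit comes from a finite stage, and there a UCP map is determined by its
restrictions along the `ι_x`. -/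
theorem corresponds_left_unique {Γ Γ' : UCP (CantorSystem X A) (H →L[ℂ] H)}
    {Φ : UCP C(A.Omega, ℂ) (ChannelAlg X H)} (h : Corresponds X Γ Φ) (h' : Corresponds X Γ' Φ) :
    Γ = Γ' := by
  refine UCP.ext fun v => ?_
  obtain ⟨n, w, rfl⟩ := InductiveLimit.exists_rep _ v
  have : Γ.comp (gammaIncl X A n) = Γ'.comp (gammaIncl X A n) :=
    Coproduct.hom_ext fun x u => (h n u x).symm.trans (h' n u x)
  exact congrArg (fun f : UCP (FinSystem (X.stage n) (A.stage n)) (H →L[ℂ] H) => f w) this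

/-- The correspondence prescribes only the level-`N` expectations of functions in `D_{A_N}`. Raising
the level of the function and averaging the expectation downwards yields all expectations of all
functions of finitely many coordinates; the rest follows by density. -/
theorem corresponds_right_unique {Γ : UCP (CantorSystem X A) (H →L[ℂ] H)}
    {Φ Φ' : UCP C(A.Omega, ℂ) (ChannelAlg X H)} (h : Corresponds X Γ Φ)
    (h' : Corresponds X Γ Φ') : Φ = Φ' := by
  have key : ∀ n (u : DiagAlg (A.stage n)), Φ (A.cantorIncl n u) = Φ' (A.cantorIncl n u) := by
    intro n u
    refine channel_ext X fun m x => ?_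
    -- The function of level `n` is rewritten as one of level `max m n`, so that a single level
    -- bounds both the function and the expectation.
    have hm : ∃ N, m ≤ N ∧ ∃ w : DiagAlg (A.stage N), A.cantorIncl n u = A.cantorIncl N w := by
      refine ⟨max m n, le_max_left _ _, ?_⟩
      generalize hN : max m n = N
      have : n ≤ N := hN ▸ le_max_right _ _
      clear hN
      induction N, this using Nat.le_induction with
      | base => exact ⟨u, rfl⟩
      | succ N _ ih =>
        obtain ⟨w, hw⟩ := ih
        exact ⟨A.diagIncl N w, hw.trans (cantorIncl_diagIncl A N w).symm⟩
    obtain ⟨N, hmN, w, hw⟩ := hm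
    rw [hw]
    -- The two sides agree at level `N` by the correspondence, and at lower levels because each
    -- expectation is the average of those one level deeper.
    suffices h : ∀ j (_ : j ≤ N) x, condExpect X j (Φ (A.cantorIncl N w)) x
        = condExpect X j (Φ' (A.cantorIncl N w)) x from h m hmN x
    intro j hj
    induction hj using Nat.decreasingInduction with
    | self => exact fun x => (h N w x).trans (h' N w x).symm
    | of_succ j hj ih =>
      intro x
      rw [condExpect_eq_average, condExpect_eq_average]
      simp only [ih]
  refine UCP.ext fun f => Subtype.ext (eq_of_forall_dist_le fun ε hε => ?_)
  -- Both maps are contractive and agree on the approximant, so each value at `f` is within `ε / 2`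
  -- of a common operator.
  obtain ⟨n, u, hu⟩ := A.exists_norm_sub_cantorIncl_le f (half_pos hε)
  have h1 := ((channelIncl X H).comp Φ).norm_le_of_continuousMap (half_pos hε) hu
  have h2 := ((channelIncl X H).comp Φ').norm_le_of_continuousMap (half_pos hε) hu
  rw [map_sub, ← dist_eq_norm] at h1 h2
  have h3 : ((channelIncl X H).comp Φ) (A.cantorIncl n u)
      = ((channelIncl X H).comp Φ') (A.cantorIncl n u) := congrArg Subtype.val (key n u)
  rw [← h3] at h2
  exact (dist_triangle_right _ _ _).trans ((add_le_add h1 h2).trans_eq (add_halves ε))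

/-- The map `u ↦ Ẽ(Φ(u))(x)` on the functions of the first coordinates. -/
def cylChannel (Φ : UCP C(A.Omega, ℂ) (ChannelAlg X H)) (n : ℕ) (x : X.stage n) :
    UCP (DiagAlg (A.stage n)) (H →L[ℂ] H) :=
  (UCP.condExpect (H := H) X n x).comp (Φ.comp (A.cantorIncl n))

theorem exists_corresponds_left (Φ : UCP C(A.Omega, ℂ) (ChannelAlg X H)) :
    ∃ Γ : UCP (CantorSystem X A) (H →L[ℂ] H), Corresponds X Γ Φ := by
  let ρ : ∀ n, UCP (FinSystem (X.stage n) (A.stage n)) (H →L[ℂ] H) := fun n =>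
    Coproduct.desc (cylChannel X Φ n)
  have hι : ∀ n x u, ρ n (Coproduct.ι (fun _ => DiagAlg (A.stage n)) x u)
      = condExpect X n (Φ (A.cantorIncl n u)) x := fun n x u =>
    Coproduct.desc_ι (cylChannel X Φ n) x u
  have hρ : ∀ n u, ρ (n + 1) (gamma X A n u) = ρ n u := by
    intro n u
    -- The average over children made by `gamma` matches the averaging of expectations, and refining
    -- the outputs leaves the continuous function on `Ω_A` unchanged.
    have : (ρ (n + 1)).comp (gamma X A n) = ρ n := Coproduct.hom_ext fun x u => by
      rw [UCP.comp_apply, gamma_ι, map_smul, map_sum, hι, condExpect_eq_average]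
      simp only [hι, cantorIncl_diagIncl]
    rw [← this, UCP.comp_apply]
  refine ⟨InductiveLimit.desc ρ hρ, fun n u x => ?_⟩
  exact (hι n x u).symm.trans (InductiveLimit.desc_ι ρ hρ n _).symm

/-- The weak limit of the step-operator maps supplies `Φ`. Its expectations are known because, for
each fixed function of finitely many coordinates and each fixed level, those of the approximants
stabilize. -/
theorem exists_corresponds_right (Γ : UCP (CantorSystem X A) (H →L[ℂ] H)) :
    ∃ Φ : UCP C(A.Omega, ℂ) (ChannelAlg X H), Corresponds X Γ Φ := by
  let g : ∀ n, X.stage n → UCP C(A.Omega, ℂ) (H →L[ℂ] H) := fun n x =>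
    Γ.comp ((gammaIncl X A n).comp
      ((Coproduct.ι (fun _ => DiagAlg (A.stage n)) x).comp (A.sample n)))
  let f : ℕ → UCP C(A.Omega, ℂ) (Lp H 2 X.mu →L[ℂ] Lp H 2 X.mu) := fun n => UCP.mulOp X n (g n)
  -- The same operators as the values of `f`, now as elements of the algebra, so that expectations
  -- can be taken and the weak limit stays inside.
  let S : ℕ → C(A.Omega, ℂ) → ChannelAlg X H := fun n v =>
    ⟨mulOp X n fun x => g n x v, mulOp_mem X n _⟩
  -- Being nonprincipal, the ultrafilter contains every set `{m | n ≤ m}`; nothing else about it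
  -- matters.
  obtain ⟨Φ, hΦ⟩ := UCP.exists_weak_limit (hyperfilter ℕ) f
  have hmem : ∀ v, Φ v ∈ (LinftyTensor X.mu H).toStarSubalgebra := fun v =>
    mem_of_weak_limit X (hyperfilter ℕ) (S := fun n => S n v) (hΦ v)
  refine ⟨Φ.codRestrict (LinftyTensor X.mu H).toStarSubalgebra hmem, fun n u x =>
    ext_inner_operator fun ξ η => ?_⟩
  have h1 := tendsto_condExpect X (S := fun m => S m (A.cantorIncl n u))
    (T := Φ.codRestrict (LinftyTensor X.mu H).toStarSubalgebra hmem (A.cantorIncl n u))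
    (hΦ (A.cantorIncl n u)) n x ξ η
  refine tendsto_nhds_unique h1 (tendsto_const_nhds.congr' ?_)
  have h2 : ∀ᶠ m in (hyperfilter ℕ : Filter ℕ), n ≤ m :=
    Nat.hyperfilter_le_atTop (eventually_ge_atTop n)
  filter_upwards [h2] with m hm
  -- The martingale hypothesis is needed only from level `n` on, where sampling the given function
  -- commutes with refinement of the outputs.
  have h3 := condExpect_mulOp_of_le X hm (fun j x => g j x (A.cantorIncl n u)) (fun j hj x => by
    change Γ (gammaIncl X A j (Coproduct.ι (fun _ => DiagAlg (A.stage j)) x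
      (A.sample j (A.cantorIncl n u)))) = _
    rw [gammaIncl_ι, map_smul, map_sum]
    simp only [← sample_cantorIncl_succ A hj]
    rfl) x
  refine congrArg (fun T : H →L[ℂ] H => inner ℂ ξ (T η)) (Eq.trans ?_ h3.symm)
  change _ = Γ (gammaIncl X A n (Coproduct.ι (fun _ => DiagAlg (A.stage n)) x
    (A.sample n (A.cantorIncl n u))))
  rw [sample_cantorIncl_self]

end Cantor

end CantorOpSys

end

theorem theorem3p3 {H : Type*} [NormedAddCommGroup H] [InnerProductSpace ℂ H] [CompleteSpace H]
    (X A : CantorOpSys.InductiveFamily) :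
    ∃ e : CantorOpSys.UCP (CantorOpSys.CantorSystem X A) (H →L[ℂ] H) ≃
        CantorOpSys.UCP C(A.Omega, ℂ) (CantorOpSys.ChannelAlg X H),
      ∀ Γ Φ, e Γ = Φ ↔ CantorOpSys.Corresponds X Γ Φ := by
  open CantorOpSys in
  choose f hf using exists_corresponds_right (H := H) (A := A) X
  choose g hg using exists_corresponds_left (H := H) (A := A) X
  -- Both inverse laws are the uniqueness statements: `Γ` and `g (f Γ)` correspond to the same `Φ`,
  -- and dually.
  refine ⟨⟨f, g, fun Γ => corresponds_left_unique X (hg _) (hf Γ),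
    fun Φ => corresponds_right_unique X (hf _) (hg Φ)⟩, fun Γ Φ => ⟨?_, fun h => ?_⟩⟩
  · rintro rfl
    exact hf Γ
  · exact corresponds_right_unique X (hf Γ) h
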